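/- Let $p$ be a prime number, $F$ a finite extension of $\mathbb{Q}_p$ with ring of integers $\mathcal{O}_F$, and $q$ the cardinality of its residue field. Let $K/F$ be a finite extension of degree $r$, with ring of integers $\mathcal{O}_K$. Let $\|\cdot\|$ be the $p$-adic norm on $F$ and $K$ normalized by $\|p\| = p^{-[F:\mathbb{Q}_p]}$; let $\lambda_F$, $\lambda_K$ be the Haar measures on $F$, $K$ with $\lambda_F(\mathcal{O}_F)=\lambda_K(\mathcal{O}_K)=1$; and let $D_K \in F$ be the discriminant of $K/F$, i.e. the determinant of the bilinear form $(u,v)\mapsto \mathrm{Tr}_{K/F}(uv)$ in an $\mathcal{O}_F$-basis of $\mathcal{O}_K$ (so that $\|D_K\|$ does not depend on the basis). For $m\ge 0$ let $\Omega_m\simeq\mathcal{O}_F^{m+1}$ be the space of polynomials of degree at most $m$ with coefficients in $\mathcal{O}_F$, with the probability measure $dQ$ corresponding to $\lambda_F^{\otimes (m+1)}$. For $n\ge 1$ and $x \in \mathcal{O}_K$ put $$\rho_{K,n}(x) = \frac{\|D_K\|}{\#(\mathcal{O}_K/\mathcal{O}_F[x])}\int_{\Omega_{n-r}}\|Q(x)\|^r\,dQ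 \quad\text{if } n\ge r \text{ and } F[x]=K,\qquad \rho_{K,n}(x)=0 \quad\text{otherwise};$$ for $x\in K\setminus\mathcal{O}_K$ put $\rho_{K,n}(x)=\|x\|^{-2r}\rho_{K,n}(x^{-1})$; and set $\rho_n(K)=\int_K\rho_{K,n}(x)\,d\lambda_K(x)$. Let $G_r$ be the number of $\alpha\in\mathbb{F}_{q^r}$ such that $\mathbb{F}_q[\alpha]=\mathbb{F}_{q^r}$. **Theorem 3.7.** If $K/F$ is unramified, then for every integer $n$ with $r\le n\le 2r-1$, the function $\rho_{K,n}$ is integrable on $K$ and $$-q^{-r}\;\le\;\frac{\rho_n(K)}{\|D_K\|}-\frac{q^{n+1}-q^r}{q^{n+1}-1}\cdot\frac{G_r}{q^r}\;\le\;4q^{-r}.$$ -/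

import Mathlib

noncomputable section

namespace RandomPadicRoots

open MeasureTheory

/-! Throughout, a finite extension of `ℚ_[p]` carries its `p`-adic norm `‖·‖` extending the norm of
`ℚ_[p]` (so `‖p‖ = p⁻¹`); the norm used for the statement is a power of it, see `normalizedNorm`. -/

section Rings

variable (F K : Type*) [NormedField F] [IsUltrametricDist F] [NormedField K] [IsUltrametricDist K]

/-- The ring of integers `{x | ‖x‖ ≤ 1}`. -/
abbrev intRing : ValuationSubring F := (NormedField.valuation (K := F)).valuationSubring

/-- The residue field of the ring of integers. -/
abbrev resField : Type _ := IsLocalRing.ResidueField (intRing F)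

/-- The norm of `K` extends that of `F`; this provides the algebra structure of the ring of
integers of `K` over that of `F`. -/
instance hasExtension [NormedAlgebra F K] :
    (NormedField.valuation (K := F)).HasExtension (NormedField.valuation (K := K)) where
  val_isEquiv_comap := by
    rw [Valuation.isEquiv_iff_val_le_one]
    intro x
    simp [NormedField.valuation_apply]

/-- `K/F` is unramified: the extension of rings of integers is (formally) unramified. -/
def IsUnramified [NormedAlgebra F K] : Prop :=
  Algebra.FormallyUnramified (intRing F) (intRing K)

open Classical in
/-- The discriminant of `K/F`: the determinant of the trace form `(u, v) ↦ Tr_{K/F}(uv)` in a basis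
of the ring of integers of `K` over that of `F`. (It depends on the basis only up to the square of
a unit, so its norm does not.) -/
def discriminant [NormedAlgebra F K] : F :=
  if h : Nonempty (Module.Basis (Fin (Module.finrank F K)) (intRing F) (intRing K)) then
    Algebra.discr F (fun i => ((h.some i : intRing K) : K))
  else 0

variable {K} in
/-- The index `#(𝒪_K / 𝒪_F[x])` (used for `x` in the ring of integers of `K`). -/
def orderIndex [NormedAlgebra F K] (x : K) : ℕ :=
  (Algebra.adjoin (intRing F) ({x} : Set K)).toSubring.toAddSubgroup.relIndex
    (intRing K).toSubring.toAddSubgroup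

end Rings

/-- The number of `α` in `l` with `k[α] = l`. -/
def numGenerators (k l : Type*) [Field k] [Field l] [Algebra k l] : ℕ :=
  Nat.card {α : l // Algebra.adjoin k ({α} : Set l) = ⊤}

section Haar

variable (K : Type*) [NormedField K] [MeasurableSpace K] [BorelSpace K]

open Classical in
/-- The Haar measure of the locally compact field `K`, normalized so that the ring of integers
(the closed unit ball) has measure `1`. -/
def haarInt : Measure K :=
  if h : IsCompact (Metric.closedBall (0 : K) 1) then
    Measure.addHaarMeasure ⟨⟨Metric.closedBall (0 : K) 1, h⟩,
      ⟨0, interior_mono Metric.ball_subset_closedBall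
        (by rw [Metric.isOpen_ball.interior_eq]; exact Metric.mem_ball_self one_pos)⟩⟩
  else 0

/-- The space `Ω_m` of polynomials of degree at most `m` with coefficients in the ring of integers,
seen as coefficient vectors, carries the product of the normalized Haar measures. -/
def polyMeasure (m : ℕ) : Measure (Fin (m + 1) → K) :=
  Measure.pi fun _ => (haarInt K).restrict (Metric.closedBall (0 : K) 1)

end Haar

section Density

variable (p : ℕ) [Fact p.Prime] (F : Type*) [NormedField F] [NormedAlgebra ℚ_[p] F]

/-- The `p`-adic norm normalized by `p ↦ p ^ (-[F : ℚ_p])`, on `F` and on extensions of `F`. -/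
def normalizedNorm {K : Type*} [NormedField K] (x : K) : ℝ := ‖x‖ ^ Module.finrank ℚ_[p] F

variable [IsUltrametricDist F] [MeasurableSpace F] [BorelSpace F]
  {K : Type*} [NormedField K] [NormedAlgebra F K] [IsUltrametricDist K]

open Classical in
/-- The density function on the ring of integers of `K`:
`‖D_K‖ / #(𝒪_K / 𝒪_F[x]) · ∫_{Ω_{n-r}} ‖Q(x)‖^r dQ` if `r ≤ n` and `F[x] = K`, and `0` otherwise,
where `r = [K : F]`. -/
def densityInt (n : ℕ) (x : K) : ℝ :=
  if Module.finrank F K ≤ n ∧ Algebra.adjoin F ({x} : Set K) = ⊤ then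
    normalizedNorm p F (discriminant F K) / (orderIndex F x : ℝ) *
      ∫ a : Fin (n - Module.finrank F K + 1) → F,
        normalizedNorm p F (∑ i, algebraMap F K (a i) * x ^ (i : ℕ)) ^ Module.finrank F K
          ∂(polyMeasure F (n - Module.finrank F K))
  else 0

open Classical in
/-- The density function `ρ_{K,n}`, extended outside the ring of integers by
`ρ_{K,n}(x) = ‖x‖^{-2r} ρ_{K,n}(x⁻¹)`. -/
def density (n : ℕ) (x : K) : ℝ :=
  if x ∈ intRing K then densityInt p F n x
  else (normalizedNorm p F x ^ (2 * Module.finrank F K))⁻¹ * densityInt p F n x⁻¹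

variable (K) in
/-- `ρ_n(K) = ∫_K ρ_{K,n}(x) dx`. -/
def meanRoots [MeasurableSpace K] [BorelSpace K] (n : ℕ) : ℝ :=
  ∫ x : K, density p F n x ∂(haarInt K)

end Density

end RandomPadicRoots

end

open MeasureTheory RandomPadicRoots

open MeasureTheory RandomPadicRoots

set_option linter.unusedSectionVars false

namespace RandomPadicRoots

open IsLocalRing

/-! ### Rings of integers of locally compact ultrametric fields -/

section LocalField

variable {E : Type*} [NormedField E] [IsUltrametricDist E]

/-! Write k ⊂ l for the residue fields of F and K, and D for `‖D_K‖`. As K/F is unramified, `#l =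
q^r`, a uniformizer π of F remains one in K, and `𝒪_K` is the disjoint union of `q^r` residue
classes of measure `q^{-r}`. The integral of the density is estimated class by class, then outside
`𝒪_K`.

If the residue α of x generates l over k, then Nakayama gives `𝒪_F[x] = 𝒪_K`, so the index is 1
(`orderIndex_eq_one`). Since `n - r < r`, the powers of x in Q(x) are independent modulo π, so the
norm of Q(x) is the largest norm of a coefficient of Q (`norm_sum_mul_pow`). That maximum is
geometrically distributed, and its moment is `(q^{n+1} - q^r)/(q^{n+1} - 1)` (`integral_norm_pow`).
These classes therefore give exactly the main term.

If α does not generate l, the integral of `‖Q(x)‖^r` is at most 1, and the index is at least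
`#l/#k[α]` (`inv_orderIndex_le`). At most `q^d` elements α have degree d, and d ≤ r/2 for
non-generators, so the `#k[α]` add up to at most `2q^r` (`sum_card_adjoin_le`). These classes
contribute between 0 and `2Dq^{-r}`.

Outside `𝒪_K` the density is at most `D‖x‖^{-2r}`, and a geometric series over balls again bounds
the contribution by `2Dq^{-r}` (`lintegral_compl_intRing_le`). Hence the total error lies in `[0,
4Dq^{-r}]`. -/

lemma mem_intRing_iff {x : E} : x ∈ intRing E ↔ ‖x‖ ≤ 1 := by
  rw [Valuation.mem_valuationSubring_iff, NormedField.valuation_apply, ← NNReal.coe_le_coe]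
  simp

lemma norm_le_one_of_intRing (x : intRing E) : ‖(x : E)‖ ≤ 1 := mem_intRing_iff.1 x.2

lemma isUnit_intRing_iff {x : intRing E} : IsUnit x ↔ ‖(x : E)‖ = 1 := by
  constructor
  · rintro ⟨u, rfl⟩
    have h : ((u : intRing E) : E) * (((u⁻¹ : (intRing E)ˣ) : intRing E) : E) = 1 := by
      exact congrArg (Subtype.val) u.mul_inv
    have h1 := norm_le_one_of_intRing (u : intRing E)
    have h2 := norm_le_one_of_intRing ((u⁻¹ : (intRing E)ˣ) : intRing E)
    have h3 := congrArg norm h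
    rw [norm_mul, norm_one] at h3
    nlinarith [norm_nonneg ((u : intRing E) : E)]
  · intro h
    have h0 : (x : E) ≠ 0 := by
      intro h0
      simp [h0] at h
    refine IsUnit.of_mul_eq_one (⟨(x : E)⁻¹, mem_intRing_iff.2 (by simp [h])⟩ : intRing E) ?_
    exact Subtype.ext (by simp [h0])

lemma mem_maximalIdeal_intRing_iff {x : intRing E} :
    x ∈ maximalIdeal (intRing E) ↔ ‖(x : E)‖ < 1 := by
  rw [mem_maximalIdeal, mem_nonunits_iff, isUnit_intRing_iff]
  exact ⟨fun h => lt_of_le_of_ne (norm_le_one_of_intRing x) h, fun h => h.ne⟩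

lemma residue_intRing_eq_iff {x y : intRing E} :
    residue (intRing E) x = residue (intRing E) y ↔ ‖(x : E) - y‖ < 1 := by
  rw [← sub_eq_zero, ← map_sub, residue_eq_zero_iff, mem_maximalIdeal_intRing_iff]
  rfl

/-- `π` generates the maximal ideal of the ring of integers, which is not zero. -/
structure IsUniformizer (π : E) : Prop where
  norm_pos : 0 < ‖π‖
  norm_lt_one : ‖π‖ < 1
  norm_le : ∀ x : E, ‖x‖ < 1 → ‖x‖ ≤ ‖π‖

/-- The open unit ball of an ultrametric space is closed, hence compact here, so the norm attains
its maximum on it. The hypothesis makes that maximum nonzero. -/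
lemma exists_isUniformizer [ProperSpace E] (h : ∃ x : E, 0 < ‖x‖ ∧ ‖x‖ < 1) :
    ∃ π : E, IsUniformizer π := by
  obtain ⟨x, hx0, hx1⟩ := h
  have hc : IsCompact (Metric.ball (0 : E) 1) :=
    Metric.isCompact_of_isClosed_isBounded (IsUltrametricDist.isClosed_ball _ _)
      Metric.isBounded_ball
  obtain ⟨π, hπ, hmax⟩ := hc.exists_isMaxOn ⟨0, by simp⟩ (continuous_norm.continuousOn)
  have hle : ∀ y : E, ‖y‖ < 1 → ‖y‖ ≤ ‖π‖ := fun y hy => hmax (by simpa using hy)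
  exact ⟨π, hx0.trans_le (hle x hx1), by simpa using hπ, hle⟩

/-- Open balls of radius 1 inside the compact unit ball are residue classes, and finitely many cover
it. -/
instance finite_resField [ProperSpace E] : Finite (resField E) := by
  obtain ⟨s, hs, hfin, hcov⟩ :=
    (isCompact_closedBall (0 : E) 1).finite_cover_balls (e := 1) one_pos
  have hs' : ∀ x ∈ s, x ∈ intRing E := fun x hx => mem_intRing_iff.2 (by simpa using hs hx)
  have : Finite s := hfin
  refine Finite.of_surjective
    (fun x : s => residue (intRing E) ⟨x, hs' x x.2⟩) fun α => ?_
  obtain ⟨y, rfl⟩ := residue_surjective α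
  have hy : (y : E) ∈ Metric.closedBall (0 : E) 1 := by simpa using norm_le_one_of_intRing y
  obtain ⟨x, hx, hxy⟩ := Set.mem_iUnion₂.1 (hcov hy)
  refine ⟨⟨x, hx⟩, residue_intRing_eq_iff.2 ?_⟩
  rw [norm_sub_rev, ← dist_eq_norm]
  exact hxy

namespace IsUniformizer

variable {π : E}

lemma ne_zero (hπ : IsUniformizer π) : π ≠ 0 := norm_pos_iff.1 hπ.norm_pos

lemma mem_intRing (hπ : IsUniformizer π) : π ∈ intRing E := mem_intRing_iff.2 hπ.norm_lt_one.le

lemma maximalIdeal_eq_span (hπ : IsUniformizer π) :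
    maximalIdeal (intRing E) = Ideal.span {(⟨π, hπ.mem_intRing⟩ : intRing E)} := by
  ext x
  rw [mem_maximalIdeal_intRing_iff, Ideal.mem_span_singleton]
  constructor
  · intro h
    refine ⟨⟨x / π, mem_intRing_iff.2 ?_⟩, Subtype.ext ?_⟩
    · rw [norm_div]
      exact div_le_one_of_le₀ (hπ.norm_le _ h) (norm_nonneg _)
    · exact (mul_div_cancel₀ _ hπ.ne_zero).symm
  · rintro ⟨y, rfl⟩
    have := norm_le_one_of_intRing y
    calc ‖π * (y : E)‖ = ‖π‖ * ‖(y : E)‖ := norm_mul _ _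
      _ ≤ ‖π‖ := mul_le_of_le_one_right (norm_nonneg _) this
      _ < 1 := hπ.norm_lt_one

/-- No norm lies strictly between consecutive powers of `‖π‖`: dividing by `π ^ k` would give an
element of norm strictly between `‖π‖` and 1. -/
lemma exists_norm_eq_pow (hπ : IsUniformizer π) {x : E} (hx0 : x ≠ 0) (hx : ‖x‖ ≤ 1) : ∃ k : ℕ, ‖x‖ = ‖π‖ ^ k := by
  obtain ⟨k, hk1, hk2⟩ := exists_nat_pow_near_of_lt_one (norm_pos_iff.2 hx0) hx
    hπ.norm_pos hπ.norm_lt_one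
  refine ⟨k, le_antisymm hk2 ?_⟩
  by_contra! h
  have h1 : ‖x / π ^ k‖ < 1 := by
    rw [norm_div, norm_pow]
    exact (div_lt_one (pow_pos hπ.norm_pos _)).2 h
  have h2 := hπ.norm_le _ h1
  rw [norm_div, norm_pow, div_le_iff₀ (pow_pos hπ.norm_pos _), ← pow_succ'] at h2
  exact absurd hk1 (not_lt.2 h2)

lemma isDiscreteValuationRing (hπ : IsUniformizer π) : IsDiscreteValuationRing (intRing E) := by
  have hirr : Irreducible (⟨π, hπ.mem_intRing⟩ : intRing E) := by
    constructor
    · rw [isUnit_intRing_iff]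
      exact hπ.norm_lt_one.ne
    · intro a b hab
      have h : π = a * b := congrArg Subtype.val hab
      by_contra! hc
      rw [isUnit_intRing_iff, isUnit_intRing_iff] at hc
      have ha := hπ.norm_le _ (lt_of_le_of_ne (norm_le_one_of_intRing a) hc.1)
      have hb := lt_of_le_of_ne (norm_le_one_of_intRing b) hc.2
      have h1 := congrArg norm h
      rw [norm_mul] at h1
      nlinarith [hπ.norm_pos, norm_nonneg (a : E), norm_nonneg (b : E)]
  refine IsDiscreteValuationRing.ofHasUnitMulPowIrreducibleFactorization
    ⟨⟨π, hπ.mem_intRing⟩, hirr, fun {x} hx => ?_⟩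
  have hx0 : (x : E) ≠ 0 := fun h => hx (Subtype.ext h)
  obtain ⟨k, hk⟩ := hπ.exists_norm_eq_pow hx0 (norm_le_one_of_intRing x)
  have hn : ‖(x : E) / π ^ k‖ = 1 := by
    rw [norm_div, norm_pow, hk, div_self (pow_pos hπ.norm_pos _).ne']
  have hu : IsUnit (⟨(x : E) / π ^ k, mem_intRing_iff.2 hn.le⟩ : intRing E) :=
    isUnit_intRing_iff.2 hn
  refine ⟨k, hu.unit, Subtype.ext ?_⟩
  exact mul_div_cancel₀ _ (pow_ne_zero _ hπ.ne_zero)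

end IsUniformizer

end LocalField

end RandomPadicRoots

namespace RandomPadicRoots

open IsLocalRing
open scoped Pointwise ENNReal

/-! ### Haar measure of balls -/

section Haar

variable {E : Type*} [NormedField E] [IsUltrametricDist E] [ProperSpace E]
  [MeasurableSpace E] [BorelSpace E]

/-- The closed unit ball, as a compact set with nonempty interior. -/
def unitBall (E : Type*) [NormedField E] [ProperSpace E] : TopologicalSpace.PositiveCompacts E :=
  ⟨⟨Metric.closedBall (0 : E) 1, isCompact_closedBall _ _⟩,
    ⟨0, interior_mono Metric.ball_subset_closedBall
      (by rw [Metric.isOpen_ball.interior_eq]; exact Metric.mem_ball_self one_pos)⟩⟩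

lemma haarInt_eq_addHaarMeasure : haarInt E = Measure.addHaarMeasure (unitBall E) := by
  rw [haarInt, dif_pos (isCompact_closedBall _ _)]
  rfl

instance : (haarInt E).IsAddHaarMeasure := by
  rw [haarInt_eq_addHaarMeasure]; infer_instance

instance : (haarInt E).Regular := by
  rw [haarInt_eq_addHaarMeasure]; infer_instance

lemma haarInt_closedBall_one : haarInt E (Metric.closedBall 0 1) = 1 := by
  rw [haarInt_eq_addHaarMeasure]
  exact Measure.addHaarMeasure_self

lemma closedBall_one_eq_iUnion (s : resField E → E)
    (hs : ∀ α, ∃ h : s α ∈ intRing E, residue (intRing E) ⟨s α, h⟩ = α) :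
    Metric.closedBall (0 : E) 1 = ⋃ α, Metric.ball (s α) 1 := by
  ext x
  rw [mem_closedBall_zero_iff, Set.mem_iUnion]
  constructor
  · intro hx
    obtain ⟨h, hα⟩ := hs (residue (intRing E) ⟨x, mem_intRing_iff.2 hx⟩)
    refine ⟨residue (intRing E) ⟨x, mem_intRing_iff.2 hx⟩, ?_⟩
    rw [Metric.mem_ball, dist_eq_norm]
    exact residue_intRing_eq_iff.1 hα.symm
  · rintro ⟨α, hα⟩
    obtain ⟨h, -⟩ := hs α
    rw [Metric.mem_ball, dist_eq_norm] at hα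
    have := (intRing E).add_mem _ _ (mem_intRing_iff.2 hα.le) h
    rw [sub_add_cancel] at this
    exact mem_intRing_iff.1 this

lemma pairwise_disjoint_ball (s : resField E → E)
    (hs : ∀ α, ∃ h : s α ∈ intRing E, residue (intRing E) ⟨s α, h⟩ = α) :
    Pairwise (Function.onFun Disjoint fun α => Metric.ball (s α) 1) := by
  intro α β hαβ
  refine Set.disjoint_left.2 fun x hx hx' => hαβ ?_
  obtain ⟨h, hα⟩ := hs α
  obtain ⟨h', hβ⟩ := hs β
  rw [← hα, ← hβ, residue_intRing_eq_iff, ← dist_eq_norm]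
  exact (IsUltrametricDist.dist_triangle_max (s α) x (s β)).trans_lt
    (max_lt (by rw [dist_comm]; exact hx) hx')

lemma exists_residue_section : ∃ s : resField E → E,
    ∀ α, ∃ h : s α ∈ intRing E, residue (intRing E) ⟨s α, h⟩ = α := by
  choose s hs using residue_surjective (R := intRing E)
  exact ⟨fun α => s α, fun α => ⟨(s α).2, hs α⟩⟩

/-- The residue classes are translates of one another and partition the unit ball, of measure 1. -/
lemma haarInt_ball_one (x : E) :
    haarInt E (Metric.ball x 1) = (Nat.card (resField E) : ℝ≥0∞)⁻¹ := by
  obtain ⟨s, hs⟩ := exists_residue_section (E := E)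
  have htr : ∀ y : E, haarInt E (Metric.ball y 1) = haarInt E (Metric.ball x 1) := fun y => by
    rw [← measure_preimage_add (haarInt E) (x - y) (Metric.ball x 1)]
    congr 1
    ext z
    rw [Set.mem_preimage, Metric.mem_ball, Metric.mem_ball, dist_eq_norm, dist_eq_norm]
    congr! 2
    abel
  have h := haarInt_closedBall_one (E := E)
  have := Fintype.ofFinite (resField E)
  rw [closedBall_one_eq_iUnion s hs, measure_iUnion (pairwise_disjoint_ball s hs)
    (fun _ => measurableSet_ball), tsum_fintype, Finset.sum_congr rfl fun α _ => htr (s α),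
    Finset.sum_const, Finset.card_univ, nsmul_eq_mul, ← Nat.card_eq_fintype_card] at h
  exact ENNReal.eq_inv_of_mul_eq_one_left (by rw [mul_comm]; exact h)

/-- Multiplication by π scales Haar measure by a constant. It maps the closed unit ball onto the
open one, a single residue class, which determines the constant. -/
lemma IsUniformizer.haarInt_closedBall_mul {π : E} (hπ : IsUniformizer π) (ρ : ℝ) :
    haarInt E (Metric.closedBall 0 (‖π‖ * ρ)) =
      (Nat.card (resField E) : ℝ≥0∞)⁻¹ * haarInt E (Metric.closedBall 0 ρ) := by
  have hsm : ∀ ρ : ℝ, Units.mk0 π hπ.ne_zero • Metric.closedBall (0 : E) ρ =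
      Metric.closedBall 0 (‖π‖ * ρ) := by
    intro ρ
    ext x
    rw [Set.mem_smul_set_iff_inv_smul_mem, mem_closedBall_zero_iff, mem_closedBall_zero_iff,
      Units.smul_def, smul_eq_mul, norm_mul, Units.val_inv_eq_inv_val, norm_inv, Units.val_mk0,
      inv_mul_le_iff₀ hπ.norm_pos]
  have hball : Metric.closedBall (0 : E) (‖π‖ * 1) = Metric.ball 0 1 := by
    ext x
    rw [mem_closedBall_zero_iff, mem_ball_zero_iff, mul_one]
    exact ⟨fun h => h.trans_lt hπ.norm_lt_one, hπ.norm_le x⟩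
  have h1 := distribHaarChar_mul (haarInt E) (Units.mk0 π hπ.ne_zero) (Metric.closedBall 0 1)
  rw [hsm, hball, haarInt_ball_one, haarInt_closedBall_one, mul_one] at h1
  rw [← hsm, ← distribHaarChar_mul, h1]

lemma natCast_card_resField_ne_zero : (Nat.card (resField E) : ℝ≥0∞) ≠ 0 := by
  exact_mod_cast Nat.card_pos.ne'

lemma IsUniformizer.haarInt_closedBall_pow {π : E} (hπ : IsUniformizer π) (k : ℕ) :
    haarInt E (Metric.closedBall 0 (‖π‖ ^ k)) = (Nat.card (resField E) : ℝ≥0∞)⁻¹ ^ k := by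
  induction k with
  | zero => simpa using haarInt_closedBall_one
  | succ k ih => rw [pow_succ', hπ.haarInt_closedBall_mul, ih, pow_succ']

lemma IsUniformizer.haarInt_closedBall_inv_pow {π : E} (hπ : IsUniformizer π) (k : ℕ) :
    haarInt E (Metric.closedBall 0 (‖π‖ ^ k)⁻¹) = (Nat.card (resField E) : ℝ≥0∞) ^ k := by
  induction k with
  | zero => simpa using haarInt_closedBall_one
  | succ k ih =>
    have h := hπ.haarInt_closedBall_mul (‖π‖ ^ (k + 1))⁻¹
    rw [pow_succ' ‖π‖, mul_inv, mul_inv_cancel_left₀ hπ.norm_pos.ne', ih, ← mul_inv,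
      ← pow_succ'] at h
    rw [pow_succ' (Nat.card (resField E) : ℝ≥0∞), h, ENNReal.mul_inv_cancel_left natCast_card_resField_ne_zero
      (ENNReal.natCast_ne_top _)]

end Haar

end RandomPadicRoots

namespace RandomPadicRoots

open IsLocalRing

/-! ### Finite extensions, and what being unramified gives -/

section Extension

variable {F K : Type*} [NormedField F] [IsUltrametricDist F] [NormedField K] [IsUltrametricDist K]
  [NormedAlgebra F K] [FiniteDimensional F K]

lemma IsUniformizer.continuous_equivFun [CompleteSpace F] {π : F} (hπ : IsUniformizer π)
    {ι : Type*} [Finite ι] (b : Module.Basis ι F K) : Continuous b.equivFun := by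
  let : NontriviallyNormedField F := NontriviallyNormedField.ofNormNeOne
    ⟨π, hπ.ne_zero, hπ.norm_lt_one.ne⟩
  exact LinearMap.continuous_of_finiteDimensional (b.equivFun : K →ₗ[F] (ι → F))

lemma IsUniformizer.properSpace [ProperSpace F] {π : F} (hπ : IsUniformizer π) :
    ProperSpace K := by
  let : NontriviallyNormedField F := NontriviallyNormedField.ofNormNeOne
    ⟨π, hπ.ne_zero, hπ.norm_lt_one.ne⟩
  exact FiniteDimensional.proper F K

/-- Coordinates in an F-basis are bounded on the compact unit ball of K. After scaling by a power of
π they embed `𝒪_K` into a finite free module over the Noetherian ring `𝒪_F`. -/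
lemma IsUniformizer.finite_intRing [ProperSpace F] {π : F} (hπ : IsUniformizer π) :
    Module.Finite (intRing F) (intRing K) := by
  have := hπ.isDiscreteValuationRing
  have := hπ.properSpace (K := K)
  let b := Module.finBasis F K
  obtain ⟨C, hC⟩ := (isCompact_closedBall (0 : K) 1).exists_bound_of_continuousOn
    (hπ.continuous_equivFun b).continuousOn
  have hC0 : 0 ≤ C := (norm_nonneg _).trans (hC 0 (by simp))
  obtain ⟨N, hN⟩ : ∃ N : ℕ, ‖π‖ ^ N * C ≤ 1 := by
    obtain ⟨N, hN⟩ := exists_pow_lt_of_lt_one (show (0 : ℝ) < (C + 1)⁻¹ by positivity)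
      hπ.norm_lt_one
    refine ⟨N, ?_⟩
    calc ‖π‖ ^ N * C ≤ (C + 1)⁻¹ * (C + 1) := by
          gcongr
          exact le_add_of_nonneg_right zero_le_one
      _ = 1 := inv_mul_cancel₀ (by positivity)
  have hmem : ∀ (y : intRing K) i, π ^ N * b.equivFun (y : K) i ∈ intRing F := fun y i => by
    rw [mem_intRing_iff, norm_mul, norm_pow]
    refine le_trans ?_ hN
    gcongr
    exact (norm_le_pi_norm _ i).trans (hC y (by simpa using norm_le_one_of_intRing y))
  let f : intRing K →ₗ[intRing F] (Fin (Module.finrank F K) → intRing F) :=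
    { toFun := fun y i => ⟨π ^ N * b.equivFun (y : K) i, hmem y i⟩
      map_add' := fun x y => by
        ext i
        change π ^ N * b.equivFun ((x : K) + y) i = π ^ N * _ + π ^ N * _
        rw [map_add, Pi.add_apply, mul_add]
      map_smul' := fun c y => by
        ext i
        change π ^ N * b.equivFun ((c : F) • (y : K)) i = (c : F) * (π ^ N * _)
        rw [map_smul, Pi.smul_apply, smul_eq_mul]
        ring }
  refine Module.Finite.of_injective f fun x y hxy => Subtype.ext (b.equivFun.injective ?_)
  ext i
  have h := congrArg Subtype.val (congrFun hxy i)
  exact mul_left_cancel₀ (pow_ne_zero _ hπ.ne_zero) h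

lemma finrank_intRing :
    Module.finrank (intRing F) (intRing K) = Module.finrank F K :=
  (IsFractionRing.finrank_eq (intRing F) F (intRing K) K).symm

lemma IsUniformizer.free_intRing [ProperSpace F] {π : F} (hπ : IsUniformizer π) :
    Module.Free (intRing F) (intRing K) := by
  have := hπ.isDiscreteValuationRing
  have := hπ.finite_intRing (K := K)
  have : Module.IsTorsionFree (intRing F) (intRing K) :=
    inferInstanceAs (Module.IsTorsionFree (NormedField.valuation (K := F)).integer
      (NormedField.valuation (K := K)).integer)
  infer_instance

/-- No ramification hypothesis is made: the lemma serves both for the unramified K/F and for F over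
`ℚ_[p]`. -/
lemma IsUniformizer.card_quotient [ProperSpace F] {π : F} (hπ : IsUniformizer π) :
    Nat.card (intRing K ⧸ (maximalIdeal (intRing F)).map (algebraMap (intRing F) (intRing K))) =
      Nat.card (resField F) ^ Module.finrank F K := by
  have := hπ.finite_intRing (K := K)
  have := hπ.free_intRing (K := K)
  let : Field (intRing F ⧸ maximalIdeal (intRing F)) := Ideal.Quotient.field _
  have : Finite (intRing F ⧸ maximalIdeal (intRing F)) := inferInstanceAs (Finite (resField F))
  change _ = Nat.card (intRing F ⧸ maximalIdeal (intRing F)) ^ _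
  rw [← finrank_intRing, ← IsLocalRing.finrank_quotient_map]
  have := Module.Finite.of_restrictScalars_finite (intRing F) (intRing F ⧸ maximalIdeal (intRing F))
    (intRing K ⧸ (maximalIdeal (intRing F)).map (algebraMap (intRing F) (intRing K)))
  exact Module.natCard_eq_pow_finrank

lemma IsUniformizer.map_maximalIdeal {π : F} (hπ : IsUniformizer π) :
    (maximalIdeal (intRing F)).map (algebraMap (intRing F) (intRing K)) =
      Ideal.span {algebraMap (intRing F) (intRing K) ⟨π, hπ.mem_intRing⟩} := by
  rw [hπ.maximalIdeal_eq_span, Ideal.map_span, Set.image_singleton]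

lemma mem_span_singleton_iff_norm_le {x y : intRing K} (hx : x ≠ 0) :
    y ∈ Ideal.span {x} ↔ ‖(y : K)‖ ≤ ‖(x : K)‖ := by
  rw [Ideal.mem_span_singleton]
  have hx0 : (x : K) ≠ 0 := fun h => hx (Subtype.ext h)
  constructor
  · rintro ⟨z, rfl⟩
    exact (norm_mul _ _).le.trans
      (mul_le_of_le_one_right (norm_nonneg _) (norm_le_one_of_intRing z))
  · intro h
    refine ⟨⟨y / x, mem_intRing_iff.2 ?_⟩, Subtype.ext (mul_div_cancel₀ _ hx0).symm⟩
    rw [norm_div]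
    exact div_le_one_of_le₀ h (norm_nonneg _)

lemma IsUniformizer.algebraMap_ne_zero {π : F} (hπ : IsUniformizer π) :
    algebraMap (intRing F) (intRing K) ⟨π, hπ.mem_intRing⟩ ≠ 0 := by
  intro h
  have h' : algebraMap F K π = 0 := congrArg Subtype.val h
  exact hπ.ne_zero ((map_eq_zero _).1 h')

lemma IsUniformizer.map_maximalIdeal_of_isUnramified [ProperSpace F] {π : F}
    (hπ : IsUniformizer π) (hK : IsUnramified F K) :
    (maximalIdeal (intRing F)).map (algebraMap (intRing F) (intRing K)) =
      maximalIdeal (intRing K) := by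
  have := hπ.finite_intRing (K := K)
  have : Algebra.FormallyUnramified (intRing F) (intRing K) := hK
  exact Algebra.FormallyUnramified.map_maximalIdeal

lemma IsUniformizer.map_algebraMap [ProperSpace F] {π : F}
    (hπ : IsUniformizer π) (hK : IsUnramified F K) : IsUniformizer (algebraMap F K π) where
  norm_pos := by rw [norm_algebraMap']; exact hπ.norm_pos
  norm_lt_one := by rw [norm_algebraMap']; exact hπ.norm_lt_one
  norm_le x hx := by
    have h : (⟨x, mem_intRing_iff.2 hx.le⟩ : intRing K) ∈ maximalIdeal (intRing K) :=
      mem_maximalIdeal_intRing_iff.2 hx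
    rw [← hπ.map_maximalIdeal_of_isUnramified hK, hπ.map_maximalIdeal,
      mem_span_singleton_iff_norm_le hπ.algebraMap_ne_zero] at h
    exact h

lemma IsUniformizer.card_resField [ProperSpace F] {π : F}
    (hπ : IsUniformizer π) (hK : IsUnramified F K) :
    Nat.card (resField K) = Nat.card (resField F) ^ Module.finrank F K := by
  rw [← hπ.card_quotient (K := K), hπ.map_maximalIdeal_of_isUnramified hK]
  rfl

lemma one_lt_card_resField [ProperSpace F] : 1 < Nat.card (resField F) := Finite.one_lt_card

lemma IsUniformizer.finrank_resField [ProperSpace F] {π : F}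
    (hπ : IsUniformizer π) (hK : IsUnramified F K) :
    Module.finrank (resField F) (resField K) = Module.finrank F K := by
  have := hπ.properSpace (K := K)
  have h := hπ.card_resField hK
  rw [Module.natCard_eq_pow_finrank (K := resField F)] at h
  exact Nat.pow_right_injective one_lt_card_resField h

/-- A basis of `𝒪_K` over `𝒪_F` is an F-basis of K, and the trace form of a separable extension is
nondegenerate. -/
lemma IsUniformizer.discriminant_ne_zero [ProperSpace F] [Algebra.IsSeparable F K] {π : F}
    (hπ : IsUniformizer π) : discriminant F K ≠ 0 := by
  have := hπ.finite_intRing (K := K)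
  have := hπ.free_intRing (K := K)
  have hne : Nonempty (Module.Basis (Fin (Module.finrank F K)) (intRing F) (intRing K)) :=
    ⟨Module.finBasisOfFinrankEq _ _ finrank_intRing⟩
  rw [discriminant, dif_pos hne]
  have h1 : LinearIndependent (intRing F) fun i => ((hne.some i : intRing K) : K) :=
    hne.some.linearIndependent.map'
      (IsScalarTower.toAlgHom (intRing F) (intRing K) K).toLinearMap
      (LinearMap.ker_eq_bot.2 Subtype.val_injective)
  have h2 := (LinearIndependent.iff_fractionRing (intRing F) F).1 h1
  have hpos : Nonempty (Fin (Module.finrank F K)) := ⟨⟨0, Module.finrank_pos⟩⟩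
  have := Algebra.discr_not_zero_of_basis F
    (basisOfLinearIndependentOfCardEqFinrank h2 (Fintype.card_fin _))
  rwa [coe_basisOfLinearIndependentOfCardEqFinrank] at this

end Extension

/-! ### The normalized norm of a uniformizer -/

section Padic

variable {p : ℕ} [Fact p.Prime]

lemma card_resField_padic : Nat.card (resField ℚ_[p]) = p := by
  let e : ℤ_[p] ≃+* intRing ℚ_[p] :=
    { toFun := fun x => ⟨x, mem_intRing_iff.2 x.2⟩
      invFun := fun x => ⟨x, mem_intRing_iff.1 x.2⟩
      left_inv := fun _ => rfl
      right_inv := fun _ => rfl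
      map_mul' := fun _ _ => rfl
      map_add' := fun _ _ => rfl }
  rw [← Nat.card_congr (ResidueField.mapEquiv e).toEquiv,
    Nat.card_congr PadicInt.residueField.toEquiv, Nat.card_zmod]

lemma isUniformizer_padic : IsUniformizer (p : ℚ_[p]) where
  norm_pos := norm_pos_iff.2 (by exact_mod_cast (Fact.out : p.Prime).ne_zero)
  norm_lt_one := Padic.norm_p_lt_one
  norm_le x hx := by
    have h := (Padic.norm_le_pow_iff_norm_lt_pow_add_one x (-1)).2 (by simpa using hx)
    rwa [zpow_neg_one, ← Padic.norm_p] at h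

variable (p) in
-- With `‖p‖ = ‖π‖ ^ e`, the ideal generated by p is the e-th power of the maximal ideal. Counting
-- the quotient of `𝒪_F` by it in two ways gives `q ^ e = p ^ [F : ℚ_p]`; then take e-th roots.
lemma IsUniformizer.normalizedNorm_eq {F : Type*} [NormedField F] [NormedAlgebra ℚ_[p] F]
    [FiniteDimensional ℚ_[p] F] [IsUltrametricDist F] {π : F} (hπ : IsUniformizer π) :
    normalizedNorm p F π = (Nat.card (resField F) : ℝ)⁻¹ := by
  have hp := isUniformizer_padic (p := p)
  have hpF : (algebraMap ℚ_[p] F p) ≠ 0 :=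
    (map_ne_zero _).2 hp.ne_zero
  have hDVR := hπ.isDiscreteValuationRing
  obtain ⟨e, he⟩ := hπ.exists_norm_eq_pow hpF (by
    rw [norm_algebraMap']; exact hp.norm_lt_one.le)
  have hmap : (maximalIdeal (intRing ℚ_[p])).map
      (algebraMap (intRing ℚ_[p]) (intRing F)) = maximalIdeal (intRing F) ^ e := by
    have hne : (⟨π, hπ.mem_intRing⟩ : intRing F) ^ e ≠ 0 :=
      pow_ne_zero _ fun h => hπ.ne_zero (congrArg Subtype.val h)
    rw [hp.map_maximalIdeal, hπ.maximalIdeal_eq_span, Ideal.span_singleton_pow]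
    ext y
    rw [mem_span_singleton_iff_norm_le hp.algebraMap_ne_zero,
      mem_span_singleton_iff_norm_le hne]
    change ‖(y : F)‖ ≤ ‖algebraMap ℚ_[p] F p‖ ↔ ‖(y : F)‖ ≤ ‖π ^ e‖
    rw [he, norm_pow]
  have hcard := hp.card_quotient (K := F)
  have hbot : maximalIdeal (intRing F) ≠ ⊥ :=
    IsDiscreteValuationRing.not_a_field (intRing F)
  have hcp := cardQuot_pow_of_prime (P := maximalIdeal (intRing F)) (i := e) hbot
  rw [Submodule.cardQuot_apply, Submodule.cardQuot_apply] at hcp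
  rw [hmap, card_resField_padic] at hcard
  have hq : Nat.card (resField F) ^ e = p ^ Module.finrank ℚ_[p] F := hcp.symm.trans hcard
  have he0 : e ≠ 0 := by
    rintro rfl
    rw [norm_algebraMap', pow_zero] at he
    exact hp.norm_lt_one.ne he
  rw [norm_algebraMap', Padic.norm_p] at he
  refine (pow_left_inj₀ (pow_nonneg (norm_nonneg _) _) (by positivity) he0).1 ?_
  change (‖π‖ ^ _) ^ e = _
  rw [← pow_mul, mul_comm, pow_mul, ← he, inv_pow, inv_pow]
  congr 1
  exact_mod_cast hq.symm

end Padic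

end RandomPadicRoots

namespace RandomPadicRoots

open IsLocalRing Polynomial

/-! ### Generators of the residue field and the order `𝒪_F[x]` -/

section Generators

variable {F K : Type*} [NormedField F] [IsUltrametricDist F] [NormedField K] [IsUltrametricDist K]
  [NormedAlgebra F K] [FiniteDimensional F K]

lemma coe_aeval_intRing (x : intRing K) (P : (intRing F)[X]) :
    ((aeval x P : intRing K) : K) = aeval (x : K) P :=
  (aeval_algHom_apply (IsScalarTower.toAlgHom (intRing F) (intRing K) K) x P).symm

lemma residue_aeval_intRing (x : intRing K) (P : (intRing F)[X]) :
    residue (intRing K) (aeval x P) =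
      aeval (residue (intRing K) x) (P.map (algebraMap (intRing F) (resField F))) := by
  rw [aeval_map_algebraMap]
  exact (aeval_algHom_apply (IsScalarTower.toAlgHom (intRing F) (intRing K) (resField K)) x P).symm

lemma IsUniformizer.adjoin_intRing_eq_top [ProperSpace F] {π : F} (hπ : IsUniformizer π)
    (hK : IsUnramified F K) {x : intRing K}
    (hx : Algebra.adjoin (resField F) {residue (intRing K) x} = ⊤) :
    Algebra.adjoin (intRing F) {x} = ⊤ := by
  have := hπ.finite_intRing (K := K)
  rw [← Algebra.toSubmodule_eq_top, ← top_le_iff]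
  -- Nakayama: by unramifiedness, lifting a polynomial expression for the residue of y writes y as
  -- an element of `𝒪_F[x]` plus an element of `𝔪_F 𝒪_K`.
  refine Submodule.le_of_le_smul_of_le_jacobson_bot (I := maximalIdeal (intRing F))
    (Module.finite_def.1 this) (jacobson_eq_maximalIdeal ⊥ bot_ne_top).ge ?_
  intro y _
  have hy : residue (intRing K) y ∈
      Algebra.adjoin (resField F) {residue (intRing K) x} := hx ▸ Algebra.mem_top
  rw [Algebra.adjoin_singleton_eq_range_aeval] at hy
  obtain ⟨P, hP⟩ := hy
  obtain ⟨P, rfl⟩ := Polynomial.map_surjective _ (residue_surjective (R := intRing F)) P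
  have hP' : residue (intRing K) (aeval x P) = residue (intRing K) y :=
    (residue_aeval_intRing x P).trans hP
  rw [Ideal.smul_top_eq_map, hπ.map_maximalIdeal_of_isUnramified hK, Submodule.mem_sup]
  refine ⟨aeval x P, aeval_mem_adjoin_singleton _ _, y - aeval x P, ?_, add_sub_cancel _ _⟩
  rw [Submodule.restrictScalars_mem, ← residue_eq_zero_iff, map_sub, hP', sub_self]

lemma IsUniformizer.intRing_le_adjoin [ProperSpace F] {π : F} (hπ : IsUniformizer π)
    (hK : IsUnramified F K) {x : intRing K}
    (hx : Algebra.adjoin (resField F) {residue (intRing K) x} = ⊤) {y : K} (hy : y ∈ intRing K) :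
    y ∈ Algebra.adjoin (intRing F) {(x : K)} := by
  have h : (⟨y, hy⟩ : intRing K) ∈ Algebra.adjoin (intRing F) {x} :=
    hπ.adjoin_intRing_eq_top hK hx ▸ Algebra.mem_top
  rw [Algebra.adjoin_singleton_eq_range_aeval] at h ⊢
  obtain ⟨P, hP⟩ := h
  exact ⟨P, (coe_aeval_intRing x P).symm.trans (congrArg Subtype.val hP)⟩

lemma IsUniformizer.orderIndex_eq_one [ProperSpace F] {π : F} (hπ : IsUniformizer π)
    (hK : IsUnramified F K) {x : intRing K}
    (hx : Algebra.adjoin (resField F) {residue (intRing K) x} = ⊤) :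
    orderIndex F (x : K) = 1 :=
  AddSubgroup.relIndex_eq_one.2 fun _ hy => hπ.intRing_le_adjoin hK hx hy

lemma adjoin_intRing_subset_adjoin (x : K) {y : K} (hy : y ∈ Algebra.adjoin (intRing F) {x}) :
    y ∈ Algebra.adjoin F {x} := by
  have h : Algebra.adjoin (intRing F) {x} ≤
      (Algebra.adjoin F {x}).restrictScalars (intRing F) :=
    Algebra.adjoin_le (Algebra.subset_adjoin)
  exact h hy

lemma IsUniformizer.adjoin_eq_top [ProperSpace F] {π : F} (hπ : IsUniformizer π)
    (hK : IsUnramified F K) {x : intRing K}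
    (hx : Algebra.adjoin (resField F) {residue (intRing K) x} = ⊤) :
    Algebra.adjoin F {(x : K)} = ⊤ := by
  rw [eq_top_iff]
  intro y _
  obtain ⟨N, hN⟩ : ∃ N : ℕ, ‖π ^ N • y‖ ≤ 1 := by
    obtain ⟨N, hN⟩ := exists_pow_lt_of_lt_one (show (0 : ℝ) < (‖y‖ + 1)⁻¹ by positivity)
      hπ.norm_lt_one
    refine ⟨N, ?_⟩
    rw [norm_smul, norm_pow]
    calc ‖π‖ ^ N * ‖y‖ ≤ (‖y‖ + 1)⁻¹ * (‖y‖ + 1) := by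
          gcongr
          exact le_add_of_nonneg_right zero_le_one
      _ = 1 := inv_mul_cancel₀ (by positivity)
  have h := adjoin_intRing_subset_adjoin (F := F) (x : K)
    (hπ.intRing_le_adjoin hK hx (mem_intRing_iff.2 hN))
  have h' := Subalgebra.smul_mem _ h (π ^ N)⁻¹
  rwa [inv_smul_smul₀ (pow_ne_zero _ hπ.ne_zero)] at h'

lemma norm_sum_mul_pow_le {ι : Type*} [Fintype ι] (e : ι → ℕ) (a : ι → F) {x : K} (hx : ‖x‖ ≤ 1) :
    ‖∑ i, algebraMap F K (a i) * x ^ e i‖ ≤ ‖a‖ := by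
  refine IsUltrametricDist.norm_sum_le_of_forall_le_of_nonneg (norm_nonneg _) fun i _ => ?_
  rw [norm_mul, norm_algebraMap', norm_pow]
  exact (mul_le_of_le_one_right (norm_nonneg _) (pow_le_one₀ (norm_nonneg _) hx)).trans
    (norm_le_pi_norm a i)

lemma natDegree_minpoly_of_adjoin_eq_top {k l : Type*} [Field k] [Field l] [Algebra k l]
    [FiniteDimensional k l] {α : l} (hα : Algebra.adjoin k {α} = ⊤) :
    (minpoly k α).natDegree = Module.finrank k l := by
  have hi : IsIntegral k α := .of_finite k α
  rw [(PowerBasis.ofAdjoinEqTop hi hα).finrank, PowerBasis.ofAdjoinEqTop_dim]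

/-- Divide by a coefficient of largest norm. Were the sum smaller than that norm, reduction would
give a nontrivial relation among powers of the residue with exponents below its degree. -/
lemma IsUniformizer.norm_sum_mul_pow [ProperSpace F] {π : F} (hπ : IsUniformizer π)
    (hK : IsUnramified F K) {x : intRing K}
    (hx : Algebra.adjoin (resField F) {residue (intRing K) x} = ⊤) {m : ℕ}
    (hm : m + 1 ≤ Module.finrank F K) (a : Fin (m + 1) → F) :
    ‖∑ i, algebraMap F K (a i) * (x : K) ^ (i : ℕ)‖ = ‖a‖ := by
  refine le_antisymm (norm_sum_mul_pow_le _ _ (norm_le_one_of_intRing x)) ?_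
  by_contra! hlt
  have ha0 : 0 < ‖a‖ := (norm_nonneg _).trans_lt hlt
  obtain ⟨j, -, hmax⟩ := Finset.exists_max_image Finset.univ (fun i => ‖a i‖) ⟨0, by simp⟩
  have hj : ‖a j‖ = ‖a‖ := le_antisymm (norm_le_pi_norm a j)
    ((pi_norm_le_iff_of_nonneg (norm_nonneg _)).2 fun i => hmax i (by simp))
  have haj : a j ≠ 0 := norm_pos_iff.1 (hj ▸ ha0)
  have hb : ∀ i, a i / a j ∈ intRing F := fun i => by
    rw [mem_intRing_iff, norm_div, hj]
    exact div_le_one_of_le₀ (norm_le_pi_norm a i) (norm_nonneg _)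
  let b : Fin (m + 1) → intRing F := fun i => ⟨a i / a j, hb i⟩
  have hsum : ∑ i, algebraMap (resField F) (resField K) (residue _ (b i)) *
      residue (intRing K) x ^ (i : ℕ) = 0 := by
    have h : residue (intRing K) (∑ i, algebraMap (intRing F) (intRing K) (b i) * x ^ (i : ℕ)) =
        0 := by
      rw [residue_eq_zero_iff, mem_maximalIdeal_intRing_iff]
      have : ((∑ i, algebraMap (intRing F) (intRing K) (b i) * x ^ (i : ℕ) : intRing K) : K) =
          (algebraMap F K (a j))⁻¹ * ∑ i, algebraMap F K (a i) * (x : K) ^ (i : ℕ) := by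
        rw [Finset.mul_sum]
        push_cast
        refine Finset.sum_congr rfl fun i _ => ?_
        rw [← mul_assoc, ← map_inv₀, ← map_mul, mul_comm, inv_mul_eq_div, mul_comm]
        rfl
      rw [this, norm_mul, norm_inv, norm_algebraMap', hj]
      exact (inv_mul_lt_one₀ ha0).2 hlt
    rw [map_sum] at h
    rw [← h]
    refine Finset.sum_congr rfl fun i _ => ?_
    rw [map_mul, map_pow]
    rfl
  have := hπ.properSpace (K := K)
  have hdeg := natDegree_minpoly_of_adjoin_eq_top hx
  rw [hπ.finrank_resField hK] at hdeg
  have hli := (linearIndependent_pow (K := resField F) (residue (intRing K) x)).comp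
    (Fin.castLE (hm.trans hdeg.ge)) (Fin.castLE_injective _)
  rw [Fintype.linearIndependent_iff] at hli
  have hz := hli (fun i => residue _ (b i)) (by
    rw [← hsum]
    exact Finset.sum_congr rfl fun i _ => Algebra.smul_def _ _) j
  have hbj : b j = 1 := Subtype.ext (div_self haj)
  rw [hbj, map_one] at hz
  exact one_ne_zero hz

/-- The subring `𝒪_F[x]` lies in the preimage of `k[α]` under reduction, and that preimage has the
same index as `k[α]`. -/
lemma index_adjoin_dvd_orderIndex (x : intRing K) :
    (Algebra.adjoin (resField F) {residue (intRing K) x}).toSubring.toAddSubgroup.index ∣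
      orderIndex F (x : K) := by
  let ι : intRing K →+ K := (intRing K).subtype.toAddMonoidHom
  have h1 : orderIndex F (x : K) =
      ((Algebra.adjoin (intRing F) {(x : K)}).toSubring.toAddSubgroup.comap ι).index := by
    rw [AddSubgroup.index_comap]
    have : ι.range = (intRing K).toSubring.toAddSubgroup := by
      ext y
      exact ⟨fun ⟨z, hz⟩ => hz ▸ z.2, fun hy => ⟨⟨y, hy⟩, rfl⟩⟩
    rw [this]
    rfl
  rw [h1, ← AddSubgroup.index_comap_of_surjective _
    (f := (residue (intRing K)).toAddMonoidHom) residue_surjective]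
  refine AddSubgroup.index_dvd_of_le fun y hy => ?_
  have hy' : (y : K) ∈ Algebra.adjoin (intRing F) {(x : K)} := hy
  rw [Algebra.adjoin_singleton_eq_range_aeval] at hy'
  obtain ⟨P, hP⟩ := hy'
  have hP' : aeval x P = y := Subtype.ext ((coe_aeval_intRing x P).trans hP)
  change residue (intRing K) y ∈ Algebra.adjoin (resField F) {residue (intRing K) x}
  rw [← hP', residue_aeval_intRing]
  exact aeval_mem_adjoin_singleton _ _

lemma IsUniformizer.inv_orderIndex_le [ProperSpace F] {π : F} (hπ : IsUniformizer π)
    (hK : IsUnramified F K) (x : intRing K) :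
    (orderIndex F (x : K) : ℝ)⁻¹ ≤
      Nat.card (Algebra.adjoin (resField F) {residue (intRing K) x}) /
        (Nat.card (resField F) : ℝ) ^ Module.finrank F K := by
  -- An infinite index is recorded as 0, whose inverse is 0, so the bound still holds.
  rcases Nat.eq_zero_or_pos (orderIndex F (x : K)) with h0 | h0
  · rw [h0, Nat.cast_zero, inv_zero]
    positivity
  have hle := Nat.le_of_dvd h0 (index_adjoin_dvd_orderIndex x)
  have := hπ.properSpace (K := K)
  have hmul := AddSubgroup.card_mul_index
    (Algebra.adjoin (resField F) {residue (intRing K) x}).toSubring.toAddSubgroup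
  rw [hπ.card_resField hK] at hmul
  have hq : 0 < Nat.card (resField F) := Nat.card_pos
  rw [inv_le_comm₀ (by positivity) (by
    have : 0 < Nat.card (Algebra.adjoin (resField F) {residue (intRing K) x}) := Nat.card_pos
    positivity), inv_div, div_le_iff₀ (by
    have : 0 < Nat.card (Algebra.adjoin (resField F) {residue (intRing K) x}) := Nat.card_pos
    positivity), mul_comm]
  exact_mod_cast hmul.ge.trans (Nat.mul_le_mul_left _ hle)

end Generators

end RandomPadicRoots

namespace RandomPadicRoots

open IsLocalRing Polynomial

/-! ### Measurability of the density -/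

section Measurability

variable {F K : Type*} [NormedField F] [IsUltrametricDist F] [NormedField K] [IsUltrametricDist K]
  [NormedAlgebra F K] [FiniteDimensional F K]

lemma norm_aeval_sub_aeval_le (x y : intRing K) (P : (intRing F)[X]) :
    ‖aeval (x : K) P - aeval (y : K) P‖ ≤ ‖(x : K) - y‖ := by
  obtain ⟨z, hz⟩ := sub_dvd_eval_sub x y (P.map (algebraMap (intRing F) (intRing K)))
  rw [eval_map_algebraMap, eval_map_algebraMap] at hz
  have h := congrArg (Subtype.val) hz
  have h' : aeval (x : K) P - aeval (y : K) P = ((x : K) - y) * z := by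
    rw [← coe_aeval_intRing, ← coe_aeval_intRing]
    exact h
  rw [h', norm_mul]
  exact mul_le_of_le_one_right (norm_nonneg _) (norm_le_one_of_intRing z)

lemma IsUniformizer.fg_adjoin [ProperSpace F] {π : F} (hπ : IsUniformizer π) (x : intRing K) :
    (Subalgebra.toSubmodule (Algebra.adjoin (intRing F) {(x : K)})).FG := by
  have := hπ.finite_intRing (K := K)
  have h : IsIntegral (intRing F) x := .of_finite _ x
  exact (h.map (IsScalarTower.toAlgHom (intRing F) (intRing K) K)).fg_adjoin_singleton

/-- If `F[x] = K`, then the order `𝒪_F[x]` is open in `K`. -/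
lemma IsUniformizer.exists_ball_subset_adjoin [ProperSpace F] {π : F} (hπ : IsUniformizer π)
    {x : K} (hx : Algebra.adjoin F {x} = ⊤) :
    ∃ ε > 0, ∀ y : K, ‖y‖ < ε → y ∈ Algebra.adjoin (intRing F) {x} := by
  have hi : IsIntegral F x := .of_finite F x
  let b := PowerBasis.ofAdjoinEqTop hi hx
  have hc := hπ.continuous_equivFun b.basis
  have hnhds : {y : K | ‖b.basis.equivFun y‖ < 1} ∈ nhds (0 : K) :=
    (isOpen_lt hc.norm continuous_const).mem_nhds (by simp)
  obtain ⟨ε, hε, hball⟩ := Metric.mem_nhds_iff.1 hnhds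
  refine ⟨ε, hε, fun y hy => ?_⟩
  have hy' : ‖b.basis.equivFun y‖ < 1 := hball (by simpa using hy)
  rw [← b.basis.sum_equivFun y]
  refine Subalgebra.sum_mem _ fun i _ => ?_
  have hmem : b.basis.equivFun y i ∈ intRing F :=
    mem_intRing_iff.2 ((norm_le_pi_norm _ i).trans hy'.le)
  have hpow : b.basis i ∈ Algebra.adjoin (intRing F) {x} := by
    rw [b.basis_eq_pow, PowerBasis.ofAdjoinEqTop_gen]
    exact Subalgebra.pow_mem _ (Algebra.self_mem_adjoin_singleton _ _) _
  exact Subalgebra.smul_mem _ hpow (⟨_, hmem⟩ : intRing F)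

/-- The order `𝒪_F[x]` is locally constant on the generators `x` of `K`. -/
lemma IsUniformizer.adjoin_eq_of_norm_sub_lt [ProperSpace F] {π : F} (hπ : IsUniformizer π)
    {x : intRing K} (hx : Algebra.adjoin F {(x : K)} = ⊤) :
    ∃ ε > 0, ∀ y : intRing K, ‖(x : K) - y‖ < ε →
      Algebra.adjoin (intRing F) {(y : K)} = Algebra.adjoin (intRing F) {(x : K)} := by
  obtain ⟨ε, hε, hball⟩ := hπ.exists_ball_subset_adjoin hx
  -- The factor `‖π‖` places small elements in `𝔪_F 𝒪_F[x]`, not merely in `𝒪_F[x]`, as Nakayama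
  -- requires.
  refine ⟨‖π‖ * ε, mul_pos hπ.norm_pos hε, fun y hy => ?_⟩
  have hsmul : ∀ z : K, ‖z‖ < ‖π‖ * ε → z ∈ maximalIdeal (intRing F) •
      Subalgebra.toSubmodule (Algebra.adjoin (intRing F) {(x : K)}) := fun z hz => by
    have h1 : π⁻¹ • z ∈ Algebra.adjoin (intRing F) {(x : K)} := hball _ (by
      rw [norm_smul, norm_inv]
      exact (inv_mul_lt_iff₀ hπ.norm_pos).2 hz)
    have h2 : (⟨π, hπ.mem_intRing⟩ : intRing F) • (π⁻¹ • z) = z :=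
      smul_inv_smul₀ hπ.ne_zero z
    rw [← h2]
    exact Submodule.smul_mem_smul (mem_maximalIdeal_intRing_iff.2 hπ.norm_lt_one) h1
  have hle : Algebra.adjoin (intRing F) {(x : K)} ≤ Algebra.adjoin (intRing F) {(y : K)} := by
    -- For every P, `P(x) = P(y) + (P(x) - P(y))` with the difference in `𝔪_F 𝒪_F[x]`.
    refine Subalgebra.toSubmodule.le_iff_le.1 <| Submodule.le_of_le_smul_of_le_jacobson_bot
      (I := maximalIdeal (intRing F)) (hπ.fg_adjoin x) (jacobson_eq_maximalIdeal ⊥ bot_ne_top).ge fun z hz => ?_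
    obtain ⟨P, rfl⟩ : ∃ P : (intRing F)[X], aeval (x : K) P = z := by
      have hz' : z ∈ Algebra.adjoin (intRing F) {(x : K)} := hz
      rwa [Algebra.adjoin_singleton_eq_range_aeval] at hz'
    exact Submodule.mem_sup.2 ⟨aeval (y : K) P, aeval_mem_adjoin_singleton _ _,
      aeval (x : K) P - aeval (y : K) P,
      hsmul _ ((norm_aeval_sub_aeval_le x y P).trans_lt hy), add_sub_cancel _ _⟩
  refine le_antisymm (Algebra.adjoin_singleton_le ?_) hle
  have h := Submodule.smul_le_right (hsmul _ hy)
  have h' := Subalgebra.sub_mem _ (Algebra.self_mem_adjoin_singleton (intRing F) (x : K)) h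
  rwa [sub_sub_cancel] at h'

variable (F K) in
/-- The integral generators of `K` over `F`. -/
def integralGenerators : Set K := {x | x ∈ intRing K ∧ Algebra.adjoin F {x} = ⊤}

lemma IsUniformizer.eventually_integralGenerators [ProperSpace F] {π : F} (hπ : IsUniformizer π)
    {x : K} (hx : x ∈ integralGenerators F K) :
    ∀ᶠ y in nhds x, y ∈ integralGenerators F K ∧ orderIndex F y = orderIndex F x := by
  obtain ⟨ε, hε, h⟩ := hπ.adjoin_eq_of_norm_sub_lt (x := ⟨x, hx.1⟩) hx.2
  filter_upwards [Metric.ball_mem_nhds x hε, Metric.ball_mem_nhds x one_pos] with y hy hy1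
  have hyO : y ∈ intRing K := by
    rw [Metric.mem_ball, dist_eq_norm] at hy1
    have := (intRing K).add_mem _ _ (mem_intRing_iff.2 hy1.le) hx.1
    rwa [sub_add_cancel] at this
  have hadj := h ⟨y, hyO⟩ (by rwa [← dist_eq_norm, dist_comm])
  refine ⟨⟨hyO, ?_⟩, ?_⟩
  · rw [← top_le_iff, ← hx.2]
    refine Algebra.adjoin_singleton_le (adjoin_intRing_subset_adjoin y ?_)
    change x ∈ Algebra.adjoin (intRing F) {(⟨y, hyO⟩ : intRing K).1}
    rw [hadj]
    exact Algebra.self_mem_adjoin_singleton _ _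
  · change (Algebra.adjoin (intRing F) {(⟨y, hyO⟩ : intRing K).1}).toSubring.toAddSubgroup.relIndex
      _ = _
    rw [hadj]
    rfl

variable [ProperSpace F] [MeasurableSpace K] [BorelSpace K]

lemma IsUniformizer.isOpen_integralGenerators {π : F} (hπ : IsUniformizer π) :
    IsOpen (integralGenerators F K) :=
  isOpen_iff_mem_nhds.2 fun _ hx =>
    (hπ.eventually_integralGenerators hx).mono fun _ hy => hy.1

open Classical in
lemma IsUniformizer.measurable_inv_orderIndex {π : F} (hπ : IsUniformizer π) :
    Measurable ((integralGenerators F K).piecewise (fun x => (orderIndex F x : ℝ)⁻¹) 0) := by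
  refine ContinuousOn.measurable_piecewise (fun x hx => ?_) continuousOn_const
    hπ.isOpen_integralGenerators.measurableSet
  refine ContinuousAt.continuousWithinAt ?_
  exact (continuousAt_const (y := (orderIndex F x : ℝ)⁻¹)).congr
    ((hπ.eventually_integralGenerators hx).mono fun y hy => by
      change _ = (orderIndex F y : ℝ)⁻¹
      rw [hy.2])

variable [MeasurableSpace F] [BorelSpace F] {p : ℕ} [Fact p.Prime] [NormedAlgebra ℚ_[p] F]

instance isProbabilityMeasure_polyMeasure (m : ℕ) : IsProbabilityMeasure (polyMeasure F m) := by
  have : IsProbabilityMeasure ((haarInt F).restrict (Metric.closedBall (0 : F) 1)) :=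
    ⟨by rw [Measure.restrict_apply_univ, haarInt_closedBall_one]⟩
  exact inferInstanceAs (IsProbabilityMeasure (Measure.pi _))

lemma measurableSet_intRing : MeasurableSet {x : K | x ∈ intRing K} := by
  simp_rw [mem_intRing_iff]
  exact measurableSet_le measurable_norm measurable_const

lemma IsUniformizer.measurable_integral_norm {π : F} (hπ : IsUniformizer π) (m r : ℕ) :
    Measurable fun x : K => ∫ a : Fin (m + 1) → F,
      normalizedNorm p F (∑ i, algebraMap F K (a i) * x ^ (i : ℕ)) ^ r ∂(polyMeasure F m) := by
  have := hπ.properSpace (K := K)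
  refine (StronglyMeasurable.integral_prod_right (f := fun (x : K) (a : Fin (m + 1) → F) =>
    normalizedNorm p F (∑ i, algebraMap F K (a i) * x ^ (i : ℕ)) ^ r)
    (Continuous.stronglyMeasurable ?_)).measurable
  have h : ∀ i : Fin (m + 1), Continuous fun z : K × (Fin (m + 1) → F) =>
      algebraMap F K (z.2 i) := fun i =>
    (algebraMapCLM F K).continuous.comp ((continuous_apply i).comp continuous_snd)
  unfold normalizedNorm Function.uncurry
  fun_prop

open Classical in
lemma IsUniformizer.measurable_densityInt {π : F} (hπ : IsUniformizer π) (n : ℕ) :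
    Measurable fun x : K => if x ∈ intRing K then densityInt p F n x else 0 := by
  by_cases hn : Module.finrank F K ≤ n
  · have h := ((hπ.measurable_inv_orderIndex (K := K)).const_mul
      (normalizedNorm p F (discriminant F K))).mul
      (hπ.measurable_integral_norm (K := K) (p := p) (n - Module.finrank F K)
        (Module.finrank F K))
    convert h using 2 with x
    by_cases hx : x ∈ integralGenerators F K
    · rw [Pi.mul_apply, Set.piecewise_eq_of_mem _ _ _ hx, if_pos hx.1, densityInt,
        if_pos ⟨hn, hx.2⟩, div_eq_mul_inv]
    · rw [Pi.mul_apply, Set.piecewise_eq_of_notMem _ _ _ hx, Pi.zero_apply, mul_zero, zero_mul]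
      split_ifs with hxO
      · rw [densityInt, if_neg fun h => hx ⟨hxO, h.2⟩]
      · rfl
  · have : (fun x : K => if x ∈ intRing K then densityInt p F n x else 0) = 0 := by
      ext x
      change ite _ (densityInt p F n x) _ = (0 : ℝ)
      rw [densityInt, if_neg (fun h => hn (And.left h)), ite_self]
    rw [this]
    exact measurable_zero

lemma inv_mem_intRing {x : K} (hx : x ∉ intRing K) : x⁻¹ ∈ intRing K :=
  ((intRing K).mem_or_inv_mem x).resolve_left hx

open Classical in
lemma IsUniformizer.measurable_density {π : F} (hπ : IsUniformizer π) (n : ℕ) :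
    Measurable fun x : K => density p F n x := by
  have := hπ.properSpace (K := K)
  have h := hπ.measurable_densityInt (K := K) (p := p) n
  have hn : Measurable fun x : K => (normalizedNorm p F x ^ (2 * Module.finrank F K))⁻¹ := by
    unfold normalizedNorm
    fun_prop
  have hite : Measurable fun x : K => if x ∈ intRing K then
      (if x ∈ intRing K then densityInt p F n x else 0) else
      (normalizedNorm p F x ^ (2 * Module.finrank F K))⁻¹ *
        (if x⁻¹ ∈ intRing K then densityInt p F n x⁻¹ else 0) :=
    Measurable.ite measurableSet_intRing h (hn.mul (h.comp measurable_inv))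
  refine (congrArg Measurable (funext fun x => ?_)).mpr hite
  by_cases hx : x ∈ intRing K
  · rw [density, if_pos hx, if_pos hx, if_pos hx]
  · rw [density, if_neg hx, if_neg hx, if_pos (inv_mem_intRing hx)]

end Measurability

end RandomPadicRoots

namespace RandomPadicRoots

open IsLocalRing Polynomial
open scoped ENNReal

/-! ### Moments of the largest coefficient of a random polynomial -/

section Integral

/-- The integral of a function with values in `{0} ∪ {w ^ k}` whose level sets are those of a
function with geometrically distributed values in `{0} ∪ {t ^ k}`. -/
lemma integral_comp_of_geometric {α : Type*} [MeasurableSpace α] {μ : Measure α}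
    [IsProbabilityMeasure μ] {v : α → ℝ} (hvm : Measurable v) {t s w : ℝ} (ht0 : 0 < t)
    (ht1 : t < 1) (hs0 : 0 ≤ s) (hs1 : s ≤ 1) (hw0 : 0 ≤ w) (hw1 : w < 1)
    (hv : ∀ᵐ a ∂μ, v a = 0 ∨ ∃ k : ℕ, v a = t ^ k)
    (hμ : ∀ k : ℕ, μ.real {a | v a ≤ t ^ k} = s ^ k)
    {g : ℝ → ℝ} (hg0 : g 0 = 0) (hg : ∀ k : ℕ, g (t ^ k) = w ^ k) :
    ∫ a, g (v a) ∂μ = (1 - s) / (1 - w * s) := by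
  classical
  -- Layer decomposition: where `v = t ^ j`, the sets `S k` containing the point are those with `k ≥
  -- j`, and the sum of `(1 - w) w ^ k` over `k ≥ j` is `w ^ j`.
  let S : ℕ → Set α := fun k => {a | v a ≤ t ^ (k + 1)}ᶜ
  have hS : ∀ k, MeasurableSet (S k) := fun k => (measurableSet_le hvm measurable_const).compl
  let f : ℕ → α → ℝ := fun k => (S k).indicator fun _ => (1 - w) * w ^ k
  have hws : w * s < 1 := (mul_le_of_le_one_right hw0 hs1).trans_lt hw1
  have hfi : ∀ k, Integrable (f k) μ := fun k => (integrable_const _).indicator (hS k)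
  have hf0 : ∀ k a, 0 ≤ f k a := fun k a =>
    Set.indicator_nonneg (fun _ _ => mul_nonneg (sub_nonneg.2 hw1.le) (pow_nonneg hw0 k)) a
  have hint : ∀ k, ∫ a, f k a ∂μ = (1 - w) * w ^ k - (1 - w) * s * (w * s) ^ k := fun k => by
    rw [integral_indicator_const _ (hS k), probReal_compl_eq_one_sub
      (measurableSet_le hvm measurable_const), hμ, smul_eq_mul, mul_pow]
    ring
  have hsum : HasSum (fun k => ∫ a, f k a ∂μ) ((1 - s) / (1 - w * s)) := by
    have h1 := (hasSum_geometric_of_lt_one hw0 hw1).mul_left (1 - w)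
    have h2 := (hasSum_geometric_of_lt_one (mul_nonneg hw0 hs0) hws).mul_left ((1 - w) * s)
    have hw' : 1 - w ≠ 0 := (sub_pos.2 hw1).ne'
    have hws' : 1 - w * s ≠ 0 := (sub_pos.2 hws).ne'
    have hval : (1 - w) * (1 - w)⁻¹ - (1 - w) * s * (1 - w * s)⁻¹ = (1 - s) / (1 - w * s) := by
      rw [mul_inv_cancel₀ hw', eq_div_iff hws', sub_mul, mul_assoc, inv_mul_cancel₀ hws']
      ring
    simp_rw [hint]
    rw [← hval]
    exact h1.sub h2
  have hnorm : ∀ k, ∫ a, ‖f k a‖ ∂μ = ∫ a, f k a ∂μ := fun k =>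
    integral_congr_ae (.of_forall fun a => Real.norm_of_nonneg (hf0 k a))
  have hmain := hasSum_integral_of_summable_integral_norm hfi
    (hsum.summable.congr fun k => (hnorm k).symm)
  rw [hsum.unique hmain]
  refine integral_congr_ae (hv.mono fun a ha => ?_)
  change g (v a) = ∑' k, f k a
  rcases ha with ha | ⟨j, hj⟩
  · have : ∀ k, f k a = 0 := fun k => Set.indicator_of_notMem (by
      rw [Set.notMem_compl_iff]
      exact ha.le.trans (pow_pos ht0 _).le) _
    rw [ha, hg0, tsum_congr this, tsum_zero]
  · have hmem : ∀ k, a ∈ S k ↔ j ≤ k := fun k => by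
      change ¬ (v a ≤ t ^ (k + 1)) ↔ _
      rw [hj, not_le, pow_lt_pow_iff_right_of_lt_one₀ ht0 ht1]
      omega
    have h1 := ((hasSum_geometric_of_lt_one hw0 hw1).mul_left (1 - w)).mul_left (w ^ j)
    rw [mul_inv_cancel₀ (sub_pos.2 hw1).ne', mul_one] at h1
    rw [hj, hg]
    refine (HasSum.tsum_eq ?_).symm
    rw [← (add_left_injective j).hasSum_iff]
    · have hfun : ((fun k => f k a) ∘ fun k => k + j) =
          fun k => w ^ j * ((1 - w) * w ^ k) := by
        ext k
        change (S (k + j)).indicator (fun _ => (1 - w) * w ^ (k + j)) a = _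
        rw [Set.indicator_of_mem ((hmem _).2 (Nat.le_add_left j k))]
        ring
      rw [hfun]
      exact h1
    · intro k hk
      refine Set.indicator_of_notMem (fun h => hk ⟨k - j, Nat.sub_add_cancel ((hmem k).1 h)⟩) _

variable {F : Type*} [NormedField F] [IsUltrametricDist F] [ProperSpace F]
  [MeasurableSpace F] [BorelSpace F]

lemma IsUniformizer.polyMeasure_norm_le {π : F} (hπ : IsUniformizer π) (m k : ℕ) :
    polyMeasure F m {a | ‖a‖ ≤ ‖π‖ ^ k} =
      ((Nat.card (resField F) : ℝ≥0∞)⁻¹ ^ (m + 1)) ^ k := by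
  have hset : {a : Fin (m + 1) → F | ‖a‖ ≤ ‖π‖ ^ k} =
      Set.univ.pi fun _ => Metric.closedBall (0 : F) (‖π‖ ^ k) := by
    ext a
    simp [pi_norm_le_iff_of_nonneg (pow_nonneg (norm_nonneg π) k)]
  have hsub : Metric.closedBall (0 : F) (‖π‖ ^ k) ⊆ Metric.closedBall 0 1 :=
    Metric.closedBall_subset_closedBall (pow_le_one₀ (norm_nonneg _) hπ.norm_lt_one.le)
  rw [hset, polyMeasure, Measure.pi_pi]
  simp_rw [Measure.restrict_apply measurableSet_closedBall, Set.inter_eq_left.2 hsub,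
    hπ.haarInt_closedBall_pow]
  rw [Finset.prod_const, Finset.card_univ, Fintype.card_fin, ← pow_mul, ← pow_mul, mul_comm]

lemma IsUniformizer.ae_norm_le_one {π : F} (hπ : IsUniformizer π) (m : ℕ) :
    ∀ᵐ a ∂(polyMeasure F m), ‖a‖ ≤ 1 := by
  have h := hπ.polyMeasure_norm_le m 0
  simp only [pow_zero] at h
  exact (mem_ae_iff_prob_eq_one (measurableSet_le measurable_norm measurable_const)).2 h

variable {p : ℕ} [Fact p.Prime] [NormedAlgebra ℚ_[p] F]

lemma normalizedNorm_nonneg {K : Type*} [NormedField K] (x : K) : 0 ≤ normalizedNorm p F x :=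
  pow_nonneg (norm_nonneg _) _

lemma normalizedNorm_le_one {K : Type*} [NormedField K] {x : K} (hx : ‖x‖ ≤ 1) :
    normalizedNorm p F x ≤ 1 :=
  pow_le_one₀ (norm_nonneg _) hx

variable [FiniteDimensional ℚ_[p] F]

/-- The sup norm is at most `‖π‖ ^ k` with probability `q ^ (-(m + 1) k)`, so the geometric formula
applies with `s = q ^ (-(m + 1))` and `w = q ^ (-r)`. -/
lemma IsUniformizer.integral_norm_pow {π : F} (hπ : IsUniformizer π) (m : ℕ) {r : ℕ}
    (hr : r ≠ 0) :
    ∫ a : Fin (m + 1) → F, (‖a‖ ^ Module.finrank ℚ_[p] F) ^ r ∂(polyMeasure F m) =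
      ((Nat.card (resField F) : ℝ) ^ (r + m + 1) - (Nat.card (resField F) : ℝ) ^ r) /
        ((Nat.card (resField F) : ℝ) ^ (r + m + 1) - 1) := by
  have hq1 : (1 : ℝ) < Nat.card (resField F) := by exact_mod_cast one_lt_card_resField
  have hN := hπ.normalizedNorm_eq p
  set q : ℝ := ((Nat.card (resField F) : ℕ) : ℝ) with hq
  have hq0 : 0 < q := zero_lt_one.trans hq1
  have hd : Module.finrank ℚ_[p] F ≠ 0 := Module.finrank_pos.ne'
  have hqi : q⁻¹ < 1 := inv_lt_one_of_one_lt₀ hq1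
  rw [integral_comp_of_geometric (μ := polyMeasure F m) (v := fun a => ‖a‖) (t := ‖π‖)
    (s := q⁻¹ ^ (m + 1)) (w := q⁻¹ ^ r) (g := fun y => (y ^ Module.finrank ℚ_[p] F) ^ r)
    measurable_norm hπ.norm_pos hπ.norm_lt_one (by positivity)
    (pow_le_one₀ (by positivity) hqi.le) (by positivity) (pow_lt_one₀ (by positivity) hqi hr)]
  · have h1 : q ^ (r + m + 1) - 1 ≠ 0 := (sub_pos.2 (one_lt_pow₀ hq1 (by omega))).ne'
    have h2 : 1 - q⁻¹ ^ r * q⁻¹ ^ (m + 1) ≠ 0 := by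
      rw [← pow_add]
      exact (sub_pos.2 (pow_lt_one₀ (by positivity) hqi (by omega))).ne'
    rw [div_eq_div_iff h2 h1]
    have h3 : q ^ r * q⁻¹ ^ r = 1 := by rw [← mul_pow, mul_inv_cancel₀ hq0.ne', one_pow]
    have h4 : q ^ (m + 1) * q⁻¹ ^ (m + 1) = 1 := by
      rw [← mul_pow, mul_inv_cancel₀ hq0.ne', one_pow]
    rw [add_assoc, pow_add]
    linear_combination (q ^ (m + 1) * q⁻¹ ^ (m + 1) - q⁻¹ ^ (m + 1)) * h3 + (1 - q ^ r) * h4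
  · filter_upwards [hπ.ae_norm_le_one m] with a ha
    obtain ⟨j, -, hmax⟩ := Finset.exists_max_image Finset.univ (fun i => ‖a i‖) ⟨0, by simp⟩
    have hj : ‖a j‖ = ‖a‖ := le_antisymm (norm_le_pi_norm a j)
      ((pi_norm_le_iff_of_nonneg (norm_nonneg _)).2 fun i => hmax i (by simp))
    rw [← hj] at ha ⊢
    by_cases h0 : a j = 0
    · exact Or.inl (norm_eq_zero.2 h0)
    · exact Or.inr (hπ.exists_norm_eq_pow h0 ha)
  · intro k
    rw [measureReal_def, hπ.polyMeasure_norm_le, ENNReal.toReal_pow, ENNReal.toReal_pow,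
      ENNReal.toReal_inv, ENNReal.toReal_natCast]
  · simp [hd, hr]
  · intro k
    rw [← pow_mul ‖π‖, mul_comm k, pow_mul ‖π‖]
    change (normalizedNorm p F π ^ k) ^ r = _
    rw [hN, ← pow_mul, ← pow_mul, mul_comm]

end Integral

end RandomPadicRoots

namespace RandomPadicRoots

open IsLocalRing Polynomial

/-! ### Counting non-generators of a finite field extension -/

section FiniteField

variable {k l : Type*} [Field k] [Field l] [Algebra k l] [Finite k] [FiniteDimensional k l]

lemma numGenerators_congr {l' : Type*} [Field l'] [Algebra k l'] (e : l ≃ₐ[k] l') :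
    numGenerators k l = numGenerators k l' := by
  refine Nat.card_congr (e.toEquiv.subtypeEquiv fun α => ?_)
  have h : Algebra.adjoin k {e α} = (Algebra.adjoin k {α}).map e.toAlgHom := by
    rw [AlgHom.map_adjoin, Set.image_singleton]
    rfl
  change _ ↔ Algebra.adjoin k {e α} = ⊤
  rw [h]
  constructor
  · intro h'
    rw [h', Algebra.map_top, AlgHom.range_eq_top]
    exact e.surjective
  · intro h'
    rw [eq_top_iff]
    intro x _
    obtain ⟨y, hy, hyx⟩ : e x ∈ (Algebra.adjoin k {α}).map e.toAlgHom := h' ▸ Algebra.mem_top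
    exact e.injective hyx ▸ hy

lemma toSubalgebra_adjoin_simple (α : l) :
    (IntermediateField.adjoin k {α}).toSubalgebra = Algebra.adjoin k {α} :=
  IntermediateField.adjoin_simple_toSubalgebra_of_isAlgebraic (Algebra.IsAlgebraic.isAlgebraic α)

lemma finrank_adjoin_le_half {α : l} (hα : Algebra.adjoin k {α} ≠ ⊤) :
    Module.finrank k (Algebra.adjoin k {α}) ≤ Module.finrank k l / 2 := by
  rw [← toSubalgebra_adjoin_simple] at hα ⊢
  set E := IntermediateField.adjoin k {α}
  change Module.finrank k E ≤ _
  have hmul := Module.finrank_mul_finrank k E l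
  have hpos : 0 < Module.finrank E l := Module.finrank_pos
  have hne : Module.finrank E l ≠ 1 := fun h => hα (by
    rw [IntermediateField.finrank_eq_one_iff_eq_top.1 h]
    rfl)
  rw [Nat.le_div_iff_mul_le two_pos, ← hmul]
  exact Nat.mul_le_mul_left _ (by omega)

lemma pow_card_adjoin (α : l) :
    α ^ Nat.card k ^ Module.finrank k (Algebra.adjoin k {α}) = α := by
  rw [← toSubalgebra_adjoin_simple]
  set E := IntermediateField.adjoin k {α} with hE
  change α ^ Nat.card k ^ Module.finrank k E = α
  have : Finite E := Module.finite_of_finite k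
  have := Fintype.ofFinite E
  rw [← Module.natCard_eq_pow_finrank, Nat.card_eq_fintype_card]
  exact congrArg Subtype.val
    (FiniteField.pow_card (⟨α, IntermediateField.mem_adjoin_simple_self k α⟩ : E))

lemma geom_sum_le_two_mul {Q : ℕ} (hQ : 2 ≤ Q) (m : ℕ) :
    ∑ j ∈ Finset.range (m + 1), Q ^ j ≤ 2 * Q ^ m := by
  induction m with
  | zero => simp
  | succ m ih =>
    rw [Finset.sum_range_succ, pow_succ Q m]
    nlinarith [pow_pos (zero_lt_two.trans_le hQ) m]

open Classical in
-- Elements of degree d are roots of `X ^ (q ^ d) - X`.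
lemma card_filter_finrank_adjoin_le [Fintype l] (d : ℕ) :
    (Finset.univ.filter fun α : l => Module.finrank k (Algebra.adjoin k {α}) = d).card ≤
      Nat.card k ^ d := by
  have hq : 1 < Nat.card k := Finite.one_lt_card
  rcases Nat.eq_zero_or_pos d with rfl | hd
  · rw [Finset.filter_false_of_mem]
    · simp
    · exact fun α _ => Module.finrank_pos.ne'
  have hN : 1 < Nat.card k ^ d := Nat.one_lt_pow hd.ne' hq
  refine le_trans ?_ ((card_roots' (X ^ (Nat.card k ^ d) - X : l[X])).trans
    (FiniteField.X_pow_card_sub_X_natDegree_eq l hN).le)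
  refine (Finset.card_le_card ?_).trans (Multiset.toFinset_card_le _)
  intro α hα
  rw [Finset.mem_filter] at hα
  rw [Multiset.mem_toFinset, mem_roots (FiniteField.X_pow_card_sub_X_ne_zero l hN), IsRoot.def,
    eval_sub, eval_pow, eval_X, ← hα.2, pow_card_adjoin, sub_self]

open Classical in
/-- The elements that do not generate `l` are few enough. -/
lemma sum_card_adjoin_le [Fintype l] :
    ∑ α : l with Algebra.adjoin k {α} ≠ ⊤, Nat.card (Algebra.adjoin k {α}) ≤
      2 * Nat.card k ^ Module.finrank k l := by
  have hq : 1 < Nat.card k := Finite.one_lt_card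
  rw [← Finset.sum_fiberwise_of_maps_to
    (t := Finset.range (Module.finrank k l / 2 + 1))
    (g := fun α => Module.finrank k (Algebra.adjoin k {α}))
    (fun α hα => Finset.mem_range.2
      (Nat.lt_succ_of_le (finrank_adjoin_le_half (Finset.mem_filter.1 hα).2)))]
  -- At most `q ^ d` elements have degree d, each of weight `q ^ d`; the resulting geometric sum
  -- stops at half the degree of l over k.
  calc _ ≤ ∑ d ∈ Finset.range (Module.finrank k l / 2 + 1), (Nat.card k ^ 2) ^ d := by
        refine Finset.sum_le_sum fun d _ => ?_
        calc _ ≤ ∑ α : l with Module.finrank k (Algebra.adjoin k {α}) = d,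
              Nat.card (Algebra.adjoin k {α}) := by
              refine Finset.sum_le_sum_of_subset fun α hα => ?_
              rw [Finset.mem_filter] at hα ⊢
              exact ⟨Finset.mem_univ _, hα.2⟩
          _ = ∑ α : l with Module.finrank k (Algebra.adjoin k {α}) = d, Nat.card k ^ d := by
              refine Finset.sum_congr rfl fun α hα => ?_
              rw [Module.natCard_eq_pow_finrank (K := k), (Finset.mem_filter.1 hα).2]
          _ ≤ (Nat.card k ^ 2) ^ d := by
              rw [Finset.sum_const, smul_eq_mul, ← pow_mul, two_mul, pow_add]
              exact Nat.mul_le_mul_right _ (card_filter_finrank_adjoin_le d)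
    _ ≤ 2 * (Nat.card k ^ 2) ^ (Module.finrank k l / 2) :=
        geom_sum_le_two_mul (hq.trans_le (Nat.le_self_pow two_ne_zero _)) _
    _ ≤ 2 * Nat.card k ^ Module.finrank k l := by
        rw [← pow_mul]
        exact Nat.mul_le_mul_left _ (Nat.pow_le_pow_right hq.le (Nat.mul_div_le _ _))

open Classical in
lemma numGenerators_eq_card_filter [Fintype l] :
    numGenerators k l = (Finset.univ.filter fun α : l => Algebra.adjoin k {α} = ⊤).card := by
  rw [numGenerators, Nat.card_eq_fintype_card, Fintype.card_subtype]

end FiniteField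

end RandomPadicRoots

namespace RandomPadicRoots

open IsLocalRing Polynomial
open scoped ENNReal

/-! ### Integrating the density over `𝒪_K` and its complement -/

section Density

variable {p : ℕ} [Fact p.Prime] {F K : Type*} [NormedField F] [IsUltrametricDist F]
  [NormedField K] [IsUltrametricDist K] [NormedAlgebra F K] [FiniteDimensional F K]
  [ProperSpace F] [MeasurableSpace K] [BorelSpace K] [MeasurableSpace F] [BorelSpace F]
  [NormedAlgebra ℚ_[p] F]

lemma IsUniformizer.integral_norm_mem_Icc {π : F} (hπ : IsUniformizer π) {x : K} (hx : ‖x‖ ≤ 1)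
    (m r : ℕ) :
    ∫ a : Fin (m + 1) → F, normalizedNorm p F (∑ i, algebraMap F K (a i) * x ^ (i : ℕ)) ^ r
      ∂(polyMeasure F m) ∈ Set.Icc (0 : ℝ) 1 := by
  refine ⟨integral_nonneg fun a => pow_nonneg (normalizedNorm_nonneg _) _, ?_⟩
  have h := norm_integral_le_of_norm_le_const (μ := polyMeasure F m) (C := 1)
    (f := fun a : Fin (m + 1) → F =>
      normalizedNorm p F (∑ i, algebraMap F K (a i) * x ^ (i : ℕ)) ^ r)
    ((hπ.ae_norm_le_one m).mono fun a ha => by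
      rw [Real.norm_of_nonneg (pow_nonneg (normalizedNorm_nonneg _) _)]
      exact pow_le_one₀ (normalizedNorm_nonneg _)
        (normalizedNorm_le_one ((norm_sum_mul_pow_le _ a hx).trans ha)))
  rw [probReal_univ, mul_one] at h
  exact (le_abs_self _).trans h

lemma densityInt_nonneg (n : ℕ) (x : K) : 0 ≤ densityInt p F n x := by
  rw [densityInt]
  split_ifs
  · exact mul_nonneg (div_nonneg (normalizedNorm_nonneg _) (Nat.cast_nonneg _))
      (integral_nonneg fun a => pow_nonneg (normalizedNorm_nonneg _) _)
  · exact le_rfl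

lemma IsUniformizer.densityInt_le_mul_inv {π : F} (hπ : IsUniformizer π) (n : ℕ) {x : K}
    (hx : ‖x‖ ≤ 1) :
    densityInt p F n x ≤
      normalizedNorm p F (discriminant F K) * (orderIndex F x : ℝ)⁻¹ := by
  have h0 : 0 ≤ normalizedNorm p F (discriminant F K) * (orderIndex F x : ℝ)⁻¹ :=
    mul_nonneg (normalizedNorm_nonneg _) (inv_nonneg.2 (Nat.cast_nonneg _))
  rw [densityInt]
  split_ifs
  · rw [div_eq_mul_inv]
    exact mul_le_of_le_one_right h0 (hπ.integral_norm_mem_Icc hx _ _).2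
  · exact h0

lemma IsUniformizer.densityInt_le {π : F} (hπ : IsUniformizer π) (n : ℕ) {x : K}
    (hx : ‖x‖ ≤ 1) :
    densityInt p F n x ≤ normalizedNorm p F (discriminant F K) :=
  (hπ.densityInt_le_mul_inv n hx).trans
    (mul_le_of_le_one_right (normalizedNorm_nonneg _) (Nat.cast_inv_le_one _))

variable [FiniteDimensional ℚ_[p] F]

/-- The value of the density where the residue of `x` generates the residue field of `K`. -/
lemma IsUniformizer.densityInt_eq {π : F} (hπ : IsUniformizer π) (hK : IsUnramified F K)
    {n : ℕ} (hrn : Module.finrank F K ≤ n) (hnr : n ≤ 2 * Module.finrank F K - 1)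
    {x : intRing K} (hx : Algebra.adjoin (resField F) {residue (intRing K) x} = ⊤) :
    densityInt p F n (x : K) = normalizedNorm p F (discriminant F K) *
      (((Nat.card (resField F) : ℝ) ^ (n + 1) -
        (Nat.card (resField F) : ℝ) ^ Module.finrank F K) /
        ((Nat.card (resField F) : ℝ) ^ (n + 1) - 1)) := by
  have hr : 0 < Module.finrank F K := Module.finrank_pos
  rw [densityInt, if_pos ⟨hrn, hπ.adjoin_eq_top hK hx⟩, hπ.orderIndex_eq_one hK hx,
    Nat.cast_one, div_one]
  congr 1
  have h := hπ.integral_norm_pow (p := p) (n - Module.finrank F K) hr.ne'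
  rw [Nat.add_sub_cancel' hrn] at h
  rw [← h]
  refine integral_congr_ae (.of_forall fun a => ?_)
  change (‖_‖ ^ _) ^ _ = _
  -- This is where `n ≤ 2r - 1` enters: Q has `n - r + 1 ≤ r` coefficients.
  rw [hπ.norm_sum_mul_pow hK hx (by omega)]

/-- The majorant of the density outside the ring of integers. -/
lemma IsUniformizer.lintegral_compl_intRing_le {π : F} (hπ : IsUniformizer π)
    (hK : IsUnramified F K) :
    ∫⁻ x in {x : K | x ∈ intRing K}ᶜ,
      ENNReal.ofReal (normalizedNorm p F x ^ (2 * Module.finrank F K))⁻¹ ∂(haarInt K) ≤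
      2 * (Nat.card (resField K) : ℝ≥0∞)⁻¹ := by
  have := hπ.properSpace (K := K)
  have hπK := hπ.map_algebraMap hK
  have hN := hπ.normalizedNorm_eq p
  have hcard := hπ.card_resField hK
  have hQ1 : 1 < Nat.card (resField K) := one_lt_card_resField
  set ϖ := algebraMap F K π with hϖ
  have hNϖ : normalizedNorm p F ϖ ^ Module.finrank F K = (Nat.card (resField K) : ℝ)⁻¹ := by
    rw [hcard, Nat.cast_pow, ← inv_pow, ← hN, hϖ, normalizedNorm, normalizedNorm,
      norm_algebraMap']
  set Q := Nat.card (resField K) with hQ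
  -- On the sphere of radius `‖ϖ‖ ^ (-(k + 1))` the integrand is `Q ^ (-2(k + 1))`. Enlarging the
  -- sphere to the closed ball, of measure `Q ^ (k + 1)`, leaves a convergent geometric series.
  let g : ℕ → K → ℝ≥0∞ := fun k =>
    (Metric.closedBall (0 : K) (‖ϖ‖ ^ (k + 1))⁻¹).indicator fun _ => ((Q : ℝ≥0∞)⁻¹ ^ (k + 1)) ^ 2
  have hle : ∀ x ∈ {x : K | x ∈ intRing K}ᶜ,
      ENNReal.ofReal (normalizedNorm p F x ^ (2 * Module.finrank F K))⁻¹ ≤ ∑' k, g k x := by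
    intro x hx
    have hx1 : 1 < ‖x‖ := lt_of_not_ge fun h => hx (mem_intRing_iff.2 h)
    have hx0 : x ≠ 0 := norm_pos_iff.1 (zero_lt_one.trans hx1)
    obtain ⟨j, hj⟩ := hπK.exists_norm_eq_pow (inv_ne_zero hx0)
      (mem_intRing_iff.1 (inv_mem_intRing hx))
    rw [norm_inv] at hj
    have hj0 : j ≠ 0 := by
      rintro rfl
      rw [pow_zero, inv_eq_one] at hj
      exact hx1.ne' hj
    obtain ⟨k, rfl⟩ := Nat.exists_eq_succ_of_ne_zero hj0
    have hval : (normalizedNorm p F x ^ (2 * Module.finrank F K))⁻¹ =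
        (((Q : ℝ)⁻¹) ^ (k + 1)) ^ 2 := by
      rw [← hNϖ, normalizedNorm, normalizedNorm, ← inv_pow, ← inv_pow, hj, Nat.succ_eq_add_one]
      simp only [← pow_mul]
      congr 1
      ring
    refine le_trans (le_of_eq ?_) (ENNReal.le_tsum k)
    have hmem : x ∈ Metric.closedBall (0 : K) (‖ϖ‖ ^ (k + 1))⁻¹ := by
      rw [mem_closedBall_zero_iff, ← hj, inv_inv]
    rw [hval]
    change _ = (Metric.closedBall (0 : K) (‖ϖ‖ ^ (k + 1))⁻¹).indicator _ x
    rw [Set.indicator_of_mem hmem, ENNReal.ofReal_pow (by positivity),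
      ENNReal.ofReal_pow (by positivity), ENNReal.ofReal_inv_of_pos (by positivity),
      ENNReal.ofReal_natCast]
  have hQ0 : (Q : ℝ≥0∞) ≠ 0 := natCast_card_resField_ne_zero
  have hQt : (Q : ℝ≥0∞) ≠ ⊤ := ENNReal.natCast_ne_top _
  calc _ ≤ ∫⁻ x in {x : K | x ∈ intRing K}ᶜ, ∑' k, g k x ∂(haarInt K) :=
        setLIntegral_mono' measurableSet_intRing.compl hle
    _ ≤ ∫⁻ x, ∑' k, g k x ∂(haarInt K) := setLIntegral_le_lintegral _ _
    _ = ∑' k, ∫⁻ x, g k x ∂(haarInt K) := lintegral_tsum fun k =>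
        (measurable_const.indicator measurableSet_closedBall).aemeasurable
    _ = ∑' k, (Q : ℝ≥0∞)⁻¹ * (Q : ℝ≥0∞)⁻¹ ^ k := tsum_congr fun k => by
        rw [lintegral_indicator_const measurableSet_closedBall,
          hπK.haarInt_closedBall_inv_pow, ← hQ, sq, mul_assoc, ← mul_pow,
          ENNReal.inv_mul_cancel hQ0 hQt, one_pow, mul_one, pow_succ']
    _ = (1 - (Q : ℝ≥0∞)⁻¹)⁻¹ * (Q : ℝ≥0∞)⁻¹ := by
        rw [ENNReal.tsum_mul_left, ENNReal.tsum_geometric, mul_comm]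
    _ ≤ 2 * (Q : ℝ≥0∞)⁻¹ := by
        gcongr
        rw [ENNReal.inv_le_iff_inv_le]
        -- `Q ≥ 2` bounds the factor `(1 - Q⁻¹)⁻¹` by 2.
        have h2 : (Q : ℝ≥0∞)⁻¹ ≤ 2⁻¹ := ENNReal.inv_le_inv.2 (by exact_mod_cast hQ1)
        calc (2 : ℝ≥0∞)⁻¹ = 1 - 2⁻¹ := ENNReal.one_sub_inv_two.symm
          _ ≤ 1 - (Q : ℝ≥0∞)⁻¹ := tsub_le_tsub_left h2 _

lemma density_nonneg (n : ℕ) (x : K) : 0 ≤ density p F n x := by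
  rw [density]
  split_ifs
  · exact densityInt_nonneg _ _
  · exact mul_nonneg (inv_nonneg.2 (pow_nonneg (normalizedNorm_nonneg _) _))
      (densityInt_nonneg _ _)

lemma IsUniformizer.density_le_of_notMem {π : F} (hπ : IsUniformizer π) (n : ℕ) {x : K}
    (hx : x ∉ intRing K) :
    density p F n x ≤ normalizedNorm p F (discriminant F K) *
      (normalizedNorm p F x ^ (2 * Module.finrank F K))⁻¹ := by
  rw [density, if_neg hx, mul_comm]
  exact mul_le_mul_of_nonneg_right
    (hπ.densityInt_le n (mem_intRing_iff.1 (inv_mem_intRing hx)))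
    (inv_nonneg.2 (pow_nonneg (normalizedNorm_nonneg _) _))

lemma IsUniformizer.integrableOn_compl {π : F} (hπ : IsUniformizer π) (hK : IsUnramified F K) :
    IntegrableOn (fun x : K => (normalizedNorm p F x ^ (2 * Module.finrank F K))⁻¹)
      {x : K | x ∈ intRing K}ᶜ (haarInt K) := by
  have := hπ.properSpace (K := K)
  have hm : Measurable fun x : K => (normalizedNorm p F x ^ (2 * Module.finrank F K))⁻¹ := by
    unfold normalizedNorm
    fun_prop
  refine ⟨hm.aestronglyMeasurable, ?_⟩
  rw [hasFiniteIntegral_iff_ofReal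
    (.of_forall fun x => inv_nonneg.2 (pow_nonneg (normalizedNorm_nonneg _) _))]
  exact (hπ.lintegral_compl_intRing_le hK).trans_lt
    (ENNReal.mul_lt_top (by simp) (ENNReal.inv_lt_top.2
      (pos_iff_ne_zero.2 natCast_card_resField_ne_zero)))

lemma IsUniformizer.integral_compl_le {π : F} (hπ : IsUniformizer π) (hK : IsUnramified F K) :
    ∫ x in {x : K | x ∈ intRing K}ᶜ, (normalizedNorm p F x ^ (2 * Module.finrank F K))⁻¹
      ∂(haarInt K) ≤ 2 * (Nat.card (resField K) : ℝ)⁻¹ := by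
  have := hπ.properSpace (K := K)
  rw [integral_eq_lintegral_of_nonneg_ae
    (.of_forall fun x => inv_nonneg.2 (pow_nonneg (normalizedNorm_nonneg _) _))
    (hπ.integrableOn_compl hK).1]
  refine (ENNReal.toReal_mono ?_ (hπ.lintegral_compl_intRing_le hK)).trans (le_of_eq ?_)
  · exact (ENNReal.mul_lt_top (by simp) (ENNReal.inv_lt_top.2
      (pos_iff_ne_zero.2 natCast_card_resField_ne_zero))).ne
  · simp

lemma intRing_eq_closedBall : {x : K | x ∈ intRing K} = Metric.closedBall 0 1 := by
  ext x
  rw [mem_closedBall_zero_iff]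
  exact mem_intRing_iff

lemma IsUniformizer.integrableOn_density_compl {π : F} (hπ : IsUniformizer π)
    (hK : IsUnramified F K) (n : ℕ) :
    IntegrableOn (fun x : K => density p F n x) {x : K | x ∈ intRing K}ᶜ (haarInt K) := by
  refine Integrable.mono' ((hπ.integrableOn_compl (p := p) hK).const_mul
    (normalizedNorm p F (discriminant F K))) (hπ.measurable_density n).aestronglyMeasurable ?_
  refine (ae_restrict_iff' measurableSet_intRing.compl).2 (.of_forall fun x hx => ?_)
  rw [Real.norm_of_nonneg (density_nonneg n x)]
  exact hπ.density_le_of_notMem n hx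

lemma IsUniformizer.integrable_density {π : F} (hπ : IsUniformizer π) (hK : IsUnramified F K)
    (n : ℕ) : Integrable (fun x : K => density p F n x) (haarInt K) := by
  have := hπ.properSpace (K := K)
  rw [← integrableOn_univ, ← Set.union_compl_self {x : K | x ∈ intRing K}, integrableOn_union]
  refine ⟨?_, hπ.integrableOn_density_compl hK n⟩
  refine Measure.integrableOn_of_bounded (M := normalizedNorm p F (discriminant F K)) ?_
    (hπ.measurable_density n).aestronglyMeasurable ?_
  · rw [intRing_eq_closedBall, haarInt_closedBall_one]
    exact ENNReal.one_ne_top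
  · refine (ae_restrict_iff' measurableSet_intRing).2 (.of_forall fun x hx => ?_)
    rw [Real.norm_of_nonneg (density_nonneg n x), density, if_pos (show x ∈ intRing K from hx)]
    exact hπ.densityInt_le n (mem_intRing_iff.1 hx)

lemma IsUniformizer.integral_density_compl_mem_Icc {π : F} (hπ : IsUniformizer π)
    (hK : IsUnramified F K) (n : ℕ) :
    ∫ x in {x : K | x ∈ intRing K}ᶜ, density p F n x ∂(haarInt K) ∈
      Set.Icc (0 : ℝ) (normalizedNorm p F (discriminant F K) *
        (2 * (Nat.card (resField K) : ℝ)⁻¹)) := by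
  refine ⟨integral_nonneg fun x => density_nonneg n x, ?_⟩
  refine (setIntegral_mono_on (hπ.integrableOn_density_compl hK n)
    ((hπ.integrableOn_compl (p := p) hK).const_mul (normalizedNorm p F (discriminant F K)))
    measurableSet_intRing.compl fun x hx => hπ.density_le_of_notMem n hx).trans ?_
  rw [integral_const_mul]
  exact mul_le_mul_of_nonneg_left (hπ.integral_compl_le hK) (normalizedNorm_nonneg _)

lemma haarInt_real_ball_one [ProperSpace K] (x : K) :
    (haarInt K).real (Metric.ball x 1) = (Nat.card (resField K) : ℝ)⁻¹ := by
  rw [measureReal_def, haarInt_ball_one, ENNReal.toReal_inv, ENNReal.toReal_natCast]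

open Classical in
/-- The integral of the density over the ring of integers, up to the contribution of the residue
classes that do not generate the residue field of `K`. -/
lemma IsUniformizer.integral_density_intRing_sub_mem_Icc {π : F} (hπ : IsUniformizer π)
    (hK : IsUnramified F K) {n : ℕ} (hrn : Module.finrank F K ≤ n)
    (hnr : n ≤ 2 * Module.finrank F K - 1) :
    ∫ x in {x : K | x ∈ intRing K}, density p F n x ∂(haarInt K) -
      normalizedNorm p F (discriminant F K) *
      (((Nat.card (resField F) : ℝ) ^ (n + 1) -
        (Nat.card (resField F) : ℝ) ^ Module.finrank F K) /
        ((Nat.card (resField F) : ℝ) ^ (n + 1) - 1) *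
      (numGenerators (resField F) (resField K) * (Nat.card (resField K) : ℝ)⁻¹)) ∈
      Set.Icc (0 : ℝ) (normalizedNorm p F (discriminant F K) *
        (2 * (Nat.card (resField K) : ℝ)⁻¹)) := by
  have := hπ.properSpace (K := K)
  have := Fintype.ofFinite (resField K)
  have hcard := hπ.card_resField hK
  have hQ0 : 0 < Nat.card (resField K) := Nat.card_pos
  set D := normalizedNorm p F (discriminant F K) with hD
  have hD0 : 0 ≤ D := normalizedNorm_nonneg _
  set c := ((Nat.card (resField F) : ℝ) ^ (n + 1) -
        (Nat.card (resField F) : ℝ) ^ Module.finrank F K) /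
        ((Nat.card (resField F) : ℝ) ^ (n + 1) - 1) with hc
  obtain ⟨s, hs⟩ := exists_residue_section (E := K)
  have hres : ∀ (α : resField K) (x : K), x ∈ Metric.ball (s α) 1 →
      ∃ h : x ∈ intRing K, residue (intRing K) ⟨x, h⟩ = α := by
    intro α x hx
    obtain ⟨h, hα⟩ := hs α
    rw [Metric.mem_ball, dist_eq_norm] at hx
    have hx' := (intRing K).add_mem _ _ (mem_intRing_iff.2 hx.le) h
    rw [sub_add_cancel] at hx'
    exact ⟨hx', (residue_intRing_eq_iff (x := ⟨x, hx'⟩) (y := ⟨s α, h⟩)).2 hx |>.trans hα⟩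
  have hint := hπ.integrable_density (p := p) hK n
  have hsplit : ∫ x in {x : K | x ∈ intRing K}, density p F n x ∂(haarInt K) =
      ∑ α, ∫ x in Metric.ball (s α) 1, density p F n x ∂(haarInt K) := by
    rw [intRing_eq_closedBall, closedBall_one_eq_iUnion s hs]
    exact integral_iUnion_fintype (fun _ => measurableSet_ball) (pairwise_disjoint_ball s hs)
      fun _ => hint.integrableOn
  have hgen : ∀ α : resField K, Algebra.adjoin (resField F) {α} = ⊤ →
      ∫ x in Metric.ball (s α) 1, density p F n x ∂(haarInt K) =
        D * c * (Nat.card (resField K) : ℝ)⁻¹ := by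
    intro α hα
    rw [setIntegral_congr_fun (g := fun _ => D * c) measurableSet_ball, setIntegral_const,
      haarInt_real_ball_one, smul_eq_mul, mul_comm]
    intro x hx
    obtain ⟨h, rfl⟩ := hres α x hx
    rw [density, if_pos h]
    exact hπ.densityInt_eq (x := ⟨x, h⟩) hK hrn hnr hα
  have hnongen : ∀ α : resField K,
      ∫ x in Metric.ball (s α) 1, density p F n x ∂(haarInt K) ≤
        D * (Nat.card (Algebra.adjoin (resField F) {α}) / Nat.card (resField K)) *
          (Nat.card (resField K) : ℝ)⁻¹ := by
    intro α
    refine (setIntegral_mono_on hint.integrableOn (integrableOn_const (by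
      rw [haarInt_ball_one]
      exact ENNReal.inv_ne_top.2 natCast_card_resField_ne_zero)) measurableSet_ball
      (g := fun _ => D * (Nat.card (Algebra.adjoin (resField F) {α}) / Nat.card (resField K)))
      fun x hx => ?_).trans (le_of_eq ?_)
    · obtain ⟨h, rfl⟩ := hres α x hx
      rw [density, if_pos h]
      refine (hπ.densityInt_le_mul_inv n (mem_intRing_iff.1 h)).trans
        (mul_le_mul_of_nonneg_left ?_ hD0)
      have := hπ.inv_orderIndex_le hK ⟨x, h⟩
      rwa [← Nat.cast_pow, ← hcard] at this
    · rw [setIntegral_const, haarInt_real_ball_one, smul_eq_mul, mul_comm]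
  -- The generating classes cancel the main term exactly; only the sum over the other classes
  -- remains.
  rw [hsplit, ← Finset.sum_filter_add_sum_filter_not Finset.univ
    (fun α : resField K => Algebra.adjoin (resField F) {α} = ⊤),
    Finset.sum_congr rfl (fun α hα => hgen α (Finset.mem_filter.1 hα).2), Finset.sum_const,
    ← numGenerators_eq_card_filter, nsmul_eq_mul,
    show ∀ A B G : ℝ, G * (D * c * A) + B - D * (c * (G * A)) = B from fun _ _ _ => by ring]
  constructor
  · exact Finset.sum_nonneg fun α _ => integral_nonneg fun x => density_nonneg n x
  · refine (Finset.sum_le_sum fun α _ => hnongen α).trans ?_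
    rw [← Finset.sum_mul, ← Finset.mul_sum, ← Finset.sum_div, mul_assoc]
    refine mul_le_mul_of_nonneg_left (mul_le_mul_of_nonneg_right ?_ (by positivity)) hD0
    rw [div_le_iff₀ (by positivity)]
    have h := sum_card_adjoin_le (k := resField F) (l := resField K)
    rw [← Module.natCard_eq_pow_finrank] at h
    exact_mod_cast h

end Density

end RandomPadicRoots

/-! ### Comparison of residue field models and conclusion -/

namespace RandomPadicRoots

open IsLocalRing

/-- Allows the generators to be counted in any model l of the field with `q^r` elements instead of
the residue field of K. -/
lemma nonempty_algEquiv_of_finrank_eq {k l l' : Type*} [Field k] [Finite k] [Field l] [Field l']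
    [Algebra k l] [Algebra k l'] [FiniteDimensional k l] [FiniteDimensional k l']
    (h : Module.finrank k l = Module.finrank k l') : Nonempty (l ≃ₐ[k] l') := by
  have : Finite l' := Module.finite_of_finite k
  obtain ⟨f⟩ := FiniteField.nonempty_algHom_of_finrank_dvd h.dvd
  exact ⟨AlgEquiv.ofBijective f ⟨f.injective,
    (LinearMap.injective_iff_surjective_of_finrank_eq_finrank (f := f.toLinearMap) h).1
      f.injective⟩⟩

end RandomPadicRoots

theorem theorem3p7 (p : ℕ) [Fact p.Prime]
    (F : Type*) [NormedField F] [NormedAlgebra ℚ_[p] F] [FiniteDimensional ℚ_[p] F]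
    [IsUltrametricDist F] [MeasurableSpace F] [BorelSpace F]
    (K : Type*) [NormedField K] [NormedAlgebra F K] [FiniteDimensional F K]
    [IsUltrametricDist K] [MeasurableSpace K] [BorelSpace K]
    (hK : IsUnramified F K)
    (q r : ℕ) (hq : q = Nat.card (resField F)) (hr : r = Module.finrank F K)
    (l : Type*) [Field l] [Algebra (resField F) l] (hl : Module.finrank (resField F) l = r)
    (n : ℕ) (hrn : r ≤ n) (hnr : n ≤ 2 * r - 1) :
    Integrable (fun x : K => density p F n x) (haarInt K) ∧
    -((q : ℝ) ^ r)⁻¹ ≤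
      meanRoots p F K n / normalizedNorm p F (discriminant F K) -
        ((q : ℝ) ^ (n + 1) - (q : ℝ) ^ r) / ((q : ℝ) ^ (n + 1) - 1) *
          ((numGenerators (resField F) l : ℝ) / (q : ℝ) ^ r) ∧
    meanRoots p F K n / normalizedNorm p F (discriminant F K) -
        ((q : ℝ) ^ (n + 1) - (q : ℝ) ^ r) / ((q : ℝ) ^ (n + 1) - 1) *
          ((numGenerators (resField F) l : ℝ) / (q : ℝ) ^ r) ≤
      4 * ((q : ℝ) ^ r)⁻¹ := by
  subst hr hq
  have hp := isUniformizer_padic (p := p)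
  have : ProperSpace F := hp.properSpace
  obtain ⟨π, hπ⟩ := exists_isUniformizer (E := F)
    ⟨algebraMap ℚ_[p] F p, by rw [norm_algebraMap']; exact hp.norm_pos,
      by rw [norm_algebraMap']; exact hp.norm_lt_one⟩
  have := hπ.properSpace (K := K)
  have : CharZero F := charZero_of_injective_algebraMap (algebraMap ℚ_[p] F).injective
  have hr : 0 < Module.finrank F K := Module.finrank_pos
  have : FiniteDimensional (resField F) l := Module.finite_of_finrank_pos (hl ▸ hr)
  have hrank := hπ.finrank_resField hK
  have : FiniteDimensional (resField F) (resField K) := Module.finite_of_finrank_pos (hrank ▸ hr)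
  obtain ⟨e⟩ := nonempty_algEquiv_of_finrank_eq (hl.trans hrank.symm)
  have hD : 0 < normalizedNorm p F (discriminant F K) :=
    pow_pos (norm_pos_iff.2 hπ.discriminant_ne_zero) _
  have hint := hπ.integrable_density (p := p) hK n
  have hO := hπ.integral_density_intRing_sub_mem_Icc (p := p) hK hrn hnr
  have hC := hπ.integral_density_compl_mem_Icc (p := p) hK n
  rw [hπ.card_resField hK, Nat.cast_pow, ← numGenerators_congr e] at hO
  rw [hπ.card_resField hK, Nat.cast_pow] at hC
  have hsum : meanRoots p F K n = _ :=
    (integral_add_compl (measurableSet_intRing (K := K)) hint).symm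
  have hq : 0 ≤ ((Nat.card (resField F) : ℝ) ^ Module.finrank F K)⁻¹ := by positivity
  refine ⟨hint, ?_⟩
  rw [le_sub_iff_add_le, sub_le_iff_le_add, le_div_iff₀ hD, div_le_iff₀ hD, hsum,
    div_eq_mul_inv (numGenerators (resField F) l : ℝ)]
  generalize ((Nat.card (resField F) : ℝ) ^ (n + 1) - (Nat.card (resField F) : ℝ) ^
    Module.finrank F K) / ((Nat.card (resField F) : ℝ) ^ (n + 1) - 1) = c at *
  -- Both error terms are nonnegative, so the lower bound holds even with 0; the constant 4 is 2
  -- from the non-generating classes plus 2 from the complement of `𝒪_K`.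
  constructor
  · linarith [hO.1, hC.1, mul_nonneg hD.le hq]
  · linarith [hO.2, hC.2]
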